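/- **Setting.** All vector spaces are over $\mathbb{C}$. Let $V$ be a vertex algebra (vacuum $\mathbf 1$, $Y(u,x)v=\sum_{n\in\mathbb Z}u_nv\,x^{-n-1}$, Jacobi identity), let $\mathcal D v=v_{-2}\mathbf 1$, and let $g$ be an automorphism of $V$ of finite order $T\ge 1$. Put $V^r=\{v\in V: gv=e^{-2\pi\sqrt{-1}\,r/T}v\}$ for $0\le r<T$, so $V=\bigoplus_{r=0}^{T-1}V^r$. *Modules.* A $g$-twisted $\phi$-coordinated $V$-module is a vector space $W$ with a linear map $v\mapsto Y_W(v,x)=\sum_{m\in(1/T)\mathbb Z}v_mx^{-m-1}$ from $V$ to $\mathrm{Hom}(W,W((x^{1/T})))$ such that (1) $Y_W(\mathbf 1,x)=\mathrm{id}_W$; (2) $Y_W(gv,x)$ is obtained from $Y_W(v,x)$ by replacing $x^{1/T}$ with $e^{2\pi\sqrt{-1}/T}x^{1/T}$; (3) for all $u,v\in V$ there is $k\in\mathbb N$ with $(x_1-x_2)^kY_W(u,x_1)Y_W(v,x_2)\in\mathrm{Hom}(W,W((x_1^{1/T},x_2^{1/T})))$ and $$x_2^k(e^{x_0}-1)^kY_W(Y(u,x_0)v,x_2)=\bigl((x_1-x_2)^kY_W(u,x_1)Y_W(v,x_2)\bigr)\big|_{x_1^{1/T}=(x_2e^{x_0})^{1/T}}.$$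 It is $(1/T)\mathbb N$-graded if it comes with a decomposition $W=\bigoplus_{n\in(1/T)\mathbb N}W(n)$ such that $v_mW(n)\subseteq W(n-m-1)$ for all $v\in V$, $m\in(1/T)\mathbb Z$, $n\in (1/T)\mathbb N$ (where $W(i)=0$ for $i<0$). A graded submodule is a graded subspace stable under all operators $v_m$. A graded module is simple if it is nonzero and has no graded submodules other than $0$ and itself (this holds in particular if it is nonzero and has no submodules at all other than $0$ and itself). For $i\in(1/T)\mathbb Z$ put $o_i(v)=v_{-i-1}$ and $o(v)=o_0(v)$, and for $n\in(1/T)\mathbb N$ $$\tilde\Omega_n(W)=\{w\in W:\ o_m(v)w=0\text{ for all }v\in V\text{ and all }m\in(1/T)\mathbb Z\text{ with }m<-n\}.$$ *The algebra $\tilde A_{g,n}(V)$.* Let $n\in(1/T)\mathbb N$, write $n=\lfloor n\rfloor+\bar n/T$ with $0\le\bar n<T$, and let $\delta_{\bar n}(l)=1$ if $l\le\bar n$ and $0$ otherwise. For $u\in V^r$ and $v\in V$ put $$u\diamond_{g,n}v=\mathrm{Res}_x\frac{e^{x(\delta_{\bar n}(r)+\lfloor n\rfloor+r/T)}}{(e^x-1)^{2\lfloor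 n\rfloor+\delta_{\bar n}(r)+\delta_{\bar n}(T-r)+1}}Y(u,x)v,$$ $$u\bullet_{g,n}v=\sum_{i=0}^{\lfloor n\rfloor}(-1)^i\binom{\lfloor n\rfloor+i}{i}\mathrm{Res}_x\frac{e^{x(\lfloor n\rfloor+1)}}{(e^x-1)^{\lfloor n\rfloor+1+i}}Y(u,x)v\ \text{ if } r=0,\qquad u\bullet_{g,n}v=0\ \text{ if } r\neq 0,$$ extended bilinearly to $V\times V$. Let $\tilde O_{g,n}(V)=\mathrm{span}\{u\diamond_{g,n}v: u,v\in V\}+\mathcal D V$ and let $\tilde A_{g,n}(V)=V/\tilde O_{g,n}(V)$, with the product induced by $\bullet_{g,n}$ and the identity $[\mathbf 1]$. An $\tilde A_{g,n}(V)$-module is a vector space $U$ with a linear map $\rho:\tilde A_{g,n}(V)\to\mathrm{End}(U)$ such that $\rho([\mathbf 1])=\mathrm{id}_U$ and $\rho([u\bullet_{g,n}v])=\rho([u])\rho([v])$ for all $u,v\in V$; it is irreducible if $U\ne0$ and the only subspaces of $U$ stable under $\rho(\tilde A_{g,n}(V))$ are $0$ and $U$. **Proposition 4.5.** Let $M=\bigoplus_{m\in(1/T)\mathbb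 N}M(m)$ be a $(1/T)\mathbb N$-graded $g$-twisted $\phi$-coordinated $V$-module and let $n\in(1/T)\mathbb N$. (1) $\tilde\Omega_n(M)\supseteq\bigoplus_{i\in(1/T)\mathbb N,\ i\le n}M(i)$. If $M$ is simple and $M(0)\ne0$, then $\tilde\Omega_n(M)=\bigoplus_{i\in(1/T)\mathbb N,\ i\le n}M(i)$. (2) If $M$ is simple and $M(m)\neq0$ for some $m\in(1/T)\mathbb N$ with $m\le n$, then $M(m)$ is an irreducible $\tilde A_{g,n}(V)$-module, where $[v]$ acts as $o(v)$; in particular $o(v)$ preserves $M(m)$ for each $v \in V$, and its restriction to $M(m)$ depends only on the class $[v]\in\tilde A_{g,n}(V)$. -/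

import Mathlib

/-- A vertex algebra structure on the complex vector space `V`.  `Y n u v` is the mode `u_n v`, so
that `Y(u, x) v = ∑ₙ (u_n v) x^{-n-1}`, and `vac` is the vacuum vector `𝟏`. -/
structure VertexAlgebra (V : Type*) [AddCommGroup V] [Module ℂ V] where
  /-- the modes: `Y n u v = u_n v` -/
  Y : ℤ → V →ₗ[ℂ] V →ₗ[ℂ] V
  /-- the vacuum vector -/
  vac : V
  /-- `Y(𝟏, x) = id` -/
  vac_left : ∀ (n : ℤ) (v : V), Y n vac v = if n = -1 then v else 0
  /-- `u_n 𝟏 = δ_{n,-1} u` for `n ≥ -1` -/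
  vac_right : ∀ (n : ℤ) (u : V), -1 ≤ n → Y n u vac = if n = -1 then u else 0
  /-- `u_n v = 0` for all sufficiently large `n` -/
  trunc : ∀ u v : V, ∃ N : ℤ, ∀ n : ℤ, N ≤ n → Y n u v = 0
  /-- The Jacobi identity applied to `w`: the equality of the coefficients of
  `z₀^{-l-1} z₁^{-m-1} z₂^{-n-1}` on both sides.  All three sums have finite support, by `trunc`. -/
  jacobi : ∀ (u v w : V) (l m n : ℤ),
    (∑ᶠ i : ℕ, ((-1 : ℂ) ^ i * (Ring.choose l i : ℤ)) • Y (l + m - i) u (Y (n + i) v w))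
      - (∑ᶠ i : ℕ, ((-1 : ℂ) ^ l * (-1 : ℂ) ^ i * (Ring.choose l i : ℤ)) •
          Y (l + n - i) v (Y (m + i) u w))
      = ∑ᶠ i : ℕ, ((Ring.choose m i : ℤ) : ℂ) • Y (m + n - i) (Y (l + i) u v) w

namespace VertexAlgebra

variable {V : Type*} [AddCommGroup V] [Module ℂ V]

/-- The operator `𝒟 v = v_{-2} 𝟏`. -/
def D (A : VertexAlgebra V) : V →ₗ[ℂ] V := (A.Y (-2)).flip A.vac

/-- A linear isomorphism `g` of `V` is an automorphism of the vertex algebra if it fixes the vacuum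
and `g (Y(u, x) v) = Y(g u, x) (g v)`. -/
structure IsAutomorphism (A : VertexAlgebra V) (g : V ≃ₗ[ℂ] V) : Prop where
  map_vac : g A.vac = A.vac
  map_Y : ∀ (n : ℤ) (u v : V), g (A.Y n u v) = A.Y n (g u) (g v)

/-- `V^r = {v | g v = e^{-2π√-1 r/T} v}`. -/
noncomputable def eigen (g : V ≃ₗ[ℂ] V) (T r : ℕ) : Submodule ℂ V :=
  Module.End.eigenspace (g : V →ₗ[ℂ] V)
    (Complex.exp (-(2 * Real.pi * Complex.I * (r : ℂ) / (T : ℂ))))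

/-- For `g` of order `T`, the projection of `V = ⨁_r V^r` onto `V^0`, that is, the average over the
powers of `g`. -/
noncomputable def proj₀ (g : V ≃ₗ[ℂ] V) (T : ℕ) (u : V) : V :=
  (T : ℂ)⁻¹ • ∑ j ∈ Finset.range T, (g ^ j) u

/-- `Res_x f(x) Y(u, x) v`, for a Laurent series `f = ∑ᵢ fᵢ xⁱ`; it equals `∑ᵢ fᵢ u_i v`, a sum with
finite support. -/
noncomputable def res (A : VertexAlgebra V) (f : LaurentSeries ℂ) (u v : V) : V :=
  ∑ᶠ i : ℤ, f.coeff i • A.Y i u v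

/-- The Laurent series `e^{a x} / (e^x - 1)^E`, with the power of `e^x - 1` expanded at `x = 0`. -/
noncomputable def kernel (a : ℂ) (E : ℕ) : LaurentSeries ℂ :=
  ((PowerSeries.rescale a (PowerSeries.exp ℂ) : PowerSeries ℂ) : LaurentSeries ℂ) /
    ((PowerSeries.exp ℂ - 1 : PowerSeries ℂ) : LaurentSeries ℂ) ^ E

/-- `δ_k(l) = 1` if `k ≥ l` and `0` otherwise.  It is only used with `k < T`, so that `δ_k(T) = 0`. -/
def δ (k l : ℕ) : ℕ := if l ≤ k then 1 else 0

/-- In this definition and in the next ones the natural number `n` stands for the index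
`n / T ∈ (1/T)ℕ`, whose floor is the integer quotient `n / T` and whose fractional part is
`(n % T) / T`.  For `u ∈ V^r`, this is
`u ⋄ v = Res_x e^{x(δ_{n̄}(r) + ⌊n⌋ + r/T)} / (e^x - 1)^{2⌊n⌋ + δ_{n̄}(r) + δ_{n̄}(T-r) + 1} Y(u,x)v`. -/
noncomputable def diamond (A : VertexAlgebra V) (T n r : ℕ) (u v : V) : V :=
  A.res (kernel ((δ (n % T) r : ℂ) + ((n / T : ℕ) : ℂ) + (r : ℂ) / (T : ℂ))
    (2 * (n / T) + δ (n % T) r + δ (n % T) (T - r) + 1)) u v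

/-- The product `•_{g,n}` of `V`.  It vanishes if `u ∈ V^r` with `0 < r < T`, and for `u ∈ V^0` it is
`∑_{i=0}^{⌊n⌋} (-1)^i binom(⌊n⌋+i, i) Res_x e^{x(⌊n⌋+1)} / (e^x-1)^{⌊n⌋+1+i} Y(u,x)v`; for general
`u` it is the linear extension. -/
noncomputable def bullet (A : VertexAlgebra V) (g : V ≃ₗ[ℂ] V) (T n : ℕ) (u v : V) : V :=
  ∑ i ∈ Finset.range (n / T + 1), ((-1 : ℂ) ^ i * (Nat.choose (n / T + i) i : ℂ)) •
    A.res (kernel (((n / T : ℕ) : ℂ) + 1) (n / T + 1 + i)) (proj₀ g T u) v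

/-- `Õ_{g,n}(V)`: the span of all `u ⋄ v`, plus the image of `𝒟`. -/
noncomputable def O (A : VertexAlgebra V) (g : V ≃ₗ[ℂ] V) (T n : ℕ) : Submodule ℂ V :=
  Submodule.span ℂ {x | ∃ r < T, ∃ u ∈ eigen g T r, ∃ v : V, x = A.diamond T n r u v}
    ⊔ LinearMap.range A.D

/-- The space `Ã_{g,n}(V) = V / Õ_{g,n}(V)`; its product is induced by `bullet`, and its identity is
the class of the vacuum. -/
abbrev Zhu (A : VertexAlgebra V) (g : V ≃ₗ[ℂ] V) (T n : ℕ) : Type _ := V ⧸ A.O g T n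

/-- `ρ` makes the vector space `U` a (unital, left) module of the algebra `Ã_{g,n}(V)`: the identity
`[𝟏]` acts as the identity, and the product `[u][v] = [u •_{g,n} v]` acts as the composition. -/
structure IsZhuModule (A : VertexAlgebra V) (g : V ≃ₗ[ℂ] V) (T n : ℕ)
    {U : Type*} [AddCommGroup U] [Module ℂ U]
    (ρ : A.Zhu g T n →ₗ[ℂ] Module.End ℂ U) : Prop where
  map_one : ρ (Submodule.Quotient.mk A.vac) = 1
  map_mul : ∀ u v : V, ρ (Submodule.Quotient.mk (A.bullet g T n u v)) =
    ρ (Submodule.Quotient.mk u) * ρ (Submodule.Quotient.mk v)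

/-- An irreducible `Ã_{g,n}(V)`-module: a nonzero one whose only submodules are `0` and itself. -/
structure IsIrreducibleZhuModule (A : VertexAlgebra V) (g : V ≃ₗ[ℂ] V) (T n : ℕ)
    {U : Type*} [AddCommGroup U] [Module ℂ U]
    (ρ : A.Zhu g T n →ₗ[ℂ] Module.End ℂ U) : Prop extends A.IsZhuModule g T n ρ where
  nontrivial : Nontrivial U
  eq_bot_or_eq_top : ∀ N : Submodule ℂ U,
    (∀ (a : A.Zhu g T n), ∀ x ∈ N, ρ a x ∈ N) → N = ⊥ ∨ N = ⊤

end VertexAlgebra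

/-- A `g`-twisted `φ`-coordinated module `W` of the vertex algebra `V`, where `g` has order `T`.
`coeff p v w` is the coefficient of `x^{p/T}` in `Y_W(v, x) w`.  As
`Y_W(v, x) = ∑_{m ∈ (1/T)ℤ} v_m x^{-m-1}`, the operator `coeff p v` is the mode `v_{-p/T-1}`, that is,
`o_{p/T}(v)`. -/
structure TwistedPhiModule {V : Type*} [AddCommGroup V] [Module ℂ V] (A : VertexAlgebra V)
    (g : V ≃ₗ[ℂ] V) (T : ℕ) (W : Type*) [AddCommGroup W] [Module ℂ W] where
  /-- the coefficient of `x^{p/T}` in `Y_W(v, x) w` -/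
  coeff : ℤ → V →ₗ[ℂ] W →ₗ[ℂ] W
  /-- `Y_W(v, x) w ∈ W((x^{1/T}))` -/
  trunc : ∀ (v : V) (w : W), ∃ N : ℤ, ∀ p : ℤ, p < N → coeff p v w = 0
  /-- `Y_W(𝟏, x) = id` -/
  vac : ∀ (p : ℤ) (w : W), coeff p A.vac w = if p = 0 then w else 0
  /-- `Y_W(g v, x)` is obtained from `Y_W(v, x)` by replacing `x^{1/T}` by `ω_T⁻¹ x^{1/T}`, where
  `ω_T = e^{-2π√-1/T}` -/
  twist : ∀ (p : ℤ) (v : V),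
    coeff p (g v) = ((Complex.exp (-(2 * Real.pi * Complex.I / (T : ℂ))))⁻¹ ^ p) • coeff p v
  /-- For all `u, v` there is a `k` such that, for all `w`, the series
  `F = (x₁ - x₂)^k Y_W(u, x₁) Y_W(v, x₂) w`, in which the coefficient of `x₁^{p/T} x₂^{q/T}` is
  `F p q` below, lies in `W((x₁^{1/T}, x₂^{1/T}))`, and
  `x₂^k (e^{x₀} - 1)^k Y_W(Y(u, x₀) v, x₂) w` is what `F` becomes under
  `x₁^{1/T} = (x₂ e^{x₀})^{1/T}`, which replaces `x₁^{p/T}` by `x₂^{p/T} ∑_{j≥0} (p/T)^j x₀^j / j!`.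
  The last clause compares the coefficients of `x₀^j x₂^{s/T}`, `j, s ∈ ℤ`; both sums have finite
  support. -/
  assoc : ∀ u v : V, ∃ k : ℕ, ∀ w : W, ∃ F : ℤ → ℤ → W,
    (∀ p q : ℤ, F p q = ∑ i ∈ Finset.range (k + 1), ((-1 : ℂ) ^ i * (Nat.choose k i : ℂ)) •
      coeff (p - T * (k - i)) u (coeff (q - T * i) v w)) ∧
    (∃ N : ℤ, ∀ p q : ℤ, p < N ∨ q < N → F p q = 0) ∧
    (∀ j s : ℤ,
      (∑ᶠ i : ℕ, (PowerSeries.coeff i ((PowerSeries.exp ℂ - 1) ^ k) : ℂ) •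
        coeff (s - T * k) (A.Y (i - j - 1) u v) w) =
      if 0 ≤ j then
        ∑ᶠ p : ℤ, (((p : ℂ) / (T : ℂ)) ^ j.toNat / (j.toNat.factorial : ℂ)) • F p (s - p)
      else 0)

namespace TwistedPhiModule

variable {V : Type*} [AddCommGroup V] [Module ℂ V] {A : VertexAlgebra V} {g : V ≃ₗ[ℂ] V} {T : ℕ}
  {W : Type*} [AddCommGroup W] [Module ℂ W]

/-- The operator `o(v) = o_0(v) = v_{-1}`. -/
def o (M : TwistedPhiModule A g T W) (v : V) : W →ₗ[ℂ] W := M.coeff 0 v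

/-- `Ω̃_n(W)` for the index `n / T`: all `w` with `o_m(v) w = 0` for all `v ∈ V` and all
`m ∈ (1/T)ℤ` less than `-n/T`. -/
def Omega (M : TwistedPhiModule A g T W) (n : ℕ) : Submodule ℂ W where
  carrier := {w | ∀ (v : V) (p : ℤ), p < -(n : ℤ) → M.coeff p v w = 0}
  add_mem' ha hb v p hp := by simp [ha v p hp, hb v p hp]
  zero_mem' v p _ := by simp
  smul_mem' c x hx v p hp := by simp [hx v p hp]

/-- A subspace is a submodule if it is stable under all modes of all `v ∈ V`. -/
def IsSubmodule (M : TwistedPhiModule A g T W) (N : Submodule ℂ W) : Prop :=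
  ∀ (p : ℤ) (v : V), ∀ w ∈ N, M.coeff p v w ∈ N

end TwistedPhiModule

/-- A `(1/T)ℕ`-graded `g`-twisted `φ`-coordinated module `W`: `deg i` is the component `W(i/T)`, and
`W` is the direct sum of them.  The condition `v_m W(n) ⊆ W(n - m - 1)` says that the coefficient
of `x^{p/T}` in `Y_W(v, x)` maps `W(i/T)` to `W((i+p)/T)`, which is `0` if `i + p < 0`. -/
structure GradedTwistedPhiModule {V : Type*} [AddCommGroup V] [Module ℂ V] (A : VertexAlgebra V)
    (g : V ≃ₗ[ℂ] V) (T : ℕ) (W : Type*) [AddCommGroup W] [Module ℂ W]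
    extends TwistedPhiModule A g T W where
  /-- the homogeneous component of degree `i / T` -/
  deg : ℕ → Submodule ℂ W
  isInternal : DirectSum.IsInternal deg
  coeff_mem : ∀ (p : ℤ) (v : V) (i j : ℕ), (j : ℤ) = i + p → ∀ w ∈ deg i, coeff p v w ∈ deg j
  coeff_eq_zero : ∀ (p : ℤ) (v : V) (i : ℕ), (i : ℤ) + p < 0 → ∀ w ∈ deg i, coeff p v w = 0

namespace GradedTwistedPhiModule

variable {V : Type*} [AddCommGroup V] [Module ℂ V] {A : VertexAlgebra V} {g : V ≃ₗ[ℂ] V} {T : ℕ}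
  {W : Type*} [AddCommGroup W] [Module ℂ W]

/-- The subspace `⨁_{i ≤ n} W(i/T)` of `W`. -/
def degLE (M : GradedTwistedPhiModule A g T W) (n : ℕ) : Submodule ℂ W :=
  ⨆ i : ℕ, ⨆ _ : i ≤ n, M.deg i

/-- A graded submodule: a submodule that is the sum of its intersections with the `W(i/T)`. -/
def IsGradedSubmodule (M : GradedTwistedPhiModule A g T W) (N : Submodule ℂ W) : Prop :=
  M.IsSubmodule N ∧ N = ⨆ i : ℕ, N ⊓ M.deg i

/-- A graded module is simple if it is nonzero and its only graded submodules are `0` and itself.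
A module without any proper nonzero submodule, graded or not, is simple in this sense. -/
structure IsSimple (M : GradedTwistedPhiModule A g T W) : Prop where
  nontrivial : Nontrivial W
  eq_bot_or_eq_top : ∀ N : Submodule ℂ W, M.IsGradedSubmodule N → N = ⊥ ∨ N = ⊤

end GradedTwistedPhiModule

/-! Take w in Ω̃_n and F = (x₁ - x₂)^K Y_W(u, x₁) Y_W(v, x₂) w with K large. Weak associativity says
that x₁ = x₂ e^x turns F into x₂^K (e^x - 1)^K Y_W(Y(u, x) v, x₂) w. Hence the zero mode of Res_x
e^{ax} / (e^x - 1)^E Y(u, x) v applied to w is a finite combination of coefficients of F, that of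
x₁^{p/T} being weighted by the residue of e^{(a + p/T)x} / (e^x - 1)^{E+K}
(`exists_forall_coeff_res_kernel_eq`). The residues that matter are binomial coefficients
(`coeff_kernel_natCast_add_one`).

Weak commutativity (`exists_mulSub_pow_prodCoeff_eq_flip`), deduced from associativity and skew
symmetry, shows that F has only exponents ≥ -n in both variables. In u ⋄ v the kernel is such that
every binomial left over vanishes (`coeff_zero_diamond`); in u • v the alternating sum of binomials
undoes the factor (x₁ - x₂)^K and leaves o(u) o(v) w (`coeff_zero_bullet`). Zero modes of 𝒟v vanish
because 𝒟 acts as x d/dx. As M(m) lies in Ω̃_n for m ≤ n, it becomes a module of the quotient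
algebra.

For simplicity, associativity also shows that the span of all v_m w, with w fixed, is already a
submodule (`isSubmodule_cyclic`), graded if w is homogeneous. In a simple module a nonzero
homogeneous w therefore reaches each homogeneous vector by a single mode
(`IsSimple.exists_coeff_eq`). Modes of shift 0 give irreducibility; modes into M(0) show that a
vector of Ω̃_n has no component of degree above n. -/

/-! ### Residues of e^{ax} / (e^x - 1)^E. -/

open PowerSeries in
theorem PowerSeries.exists_exp_sub_one_eq_X_mul :
    ∃ U : PowerSeries ℂ, constantCoeff U = 1 ∧ exp ℂ - 1 = X * U := by
  have h : (X : PowerSeries ℂ) ∣ exp ℂ - 1 := by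
    rw [X_dvd_iff]; simp
  obtain ⟨U, hU⟩ := h
  refine ⟨U, ?_, hU⟩
  have := congrArg (coeff 1) hU
  rw [show (1 : ℕ) = 0 + 1 from rfl, coeff_succ_X_mul] at this
  simpa [coeff_exp, coeff_one] using this.symm

theorem PowerSeries.exp_sub_one_ne_zero : (exp ℂ - 1 : PowerSeries ℂ) ≠ 0 := by
  intro h
  have := congrArg (coeff 1) h
  simp [coeff_exp, coeff_one] at this

theorem PowerSeries.coe_exp_sub_one_ne_zero :
    ((exp ℂ - 1 : PowerSeries ℂ) : LaurentSeries ℂ) ≠ 0 := by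
  intro h
  exact exp_sub_one_ne_zero (HahnSeries.ofPowerSeries_injective (Γ := ℤ) (by rw [h, map_zero]))

open PowerSeries in
/-- The residue of `f' / f ^ (M + 1)` for `f = x U` with `U` a unit power series. -/
theorem PowerSeries.coeff_derivative_mul_inv_pow {U : PowerSeries ℂ} (hU : constantCoeff U = 1)
    (M : ℕ) :
    coeff M (d⁄dX ℂ (X * U) * U⁻¹ ^ (M + 1)) = if M = 0 then 1 else 0 := by
  have hU0 : constantCoeff U ≠ 0 := by simp [hU]
  have hUi : U * U⁻¹ = 1 := PowerSeries.mul_inv_cancel _ hU0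
  rcases Nat.eq_zero_or_pos M with rfl | hM
  · simp [Derivation.leibniz, hU]
  rw [if_neg hM.ne']
  have h1 : d⁄dX ℂ (X * U) * U⁻¹ ^ (M + 1) = U⁻¹ ^ M + X * (d⁄dX ℂ U * U⁻¹ ^ (M + 1)) := by
    rw [Derivation.leibniz, derivative_X, smul_eq_mul, smul_eq_mul]
    linear_combination U⁻¹ ^ M * hUi
  obtain ⟨m, rfl⟩ : ∃ m, M = m + 1 := ⟨M - 1, by omega⟩
  -- Up to the factor -M, f'/f^{M+1} is the derivative of f^{-M}, and a derivative has no residue;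
  -- here this is read off from power series in U.
  have h2 : d⁄dX ℂ (U⁻¹ ^ (m + 1)) = -((m + 1 : ℕ) : PowerSeries ℂ) *
      (d⁄dX ℂ U * U⁻¹ ^ (m + 1 + 1)) := by
    rw [derivative_pow, derivative_inv', Nat.add_sub_cancel]
    ring
  have h3 := congrArg (coeff m) h2
  rw [coeff_derivative, ← map_natCast (C (R := ℂ)), ← map_neg, coeff_C_mul] at h3
  rw [h1, map_add, coeff_succ_X_mul]
  have h4 : ((m : ℂ) + 1) ≠ 0 := by exact_mod_cast Nat.succ_ne_zero m
  apply mul_left_cancel₀ h4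
  push_cast at h3
  linear_combination h3

namespace VertexAlgebra

open PowerSeries

theorem kernel_mul_div (a b : ℂ) (E K : ℕ) :
    kernel a E * (((rescale b (exp ℂ) : PowerSeries ℂ) : LaurentSeries ℂ) /
      ((exp ℂ - 1 : PowerSeries ℂ) : LaurentSeries ℂ) ^ K) = kernel (a + b) (E + K) := by
  unfold kernel
  rw [← exp_mul_exp_eq_exp_add, coe_mul, pow_add, div_mul_div_comm]

/-- Writing e^x = (e^x - 1) + 1 in the numerator gives Pascal's rule for kernels. -/
theorem kernel_add_one (a : ℂ) (E : ℕ) :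
    kernel (a + 1) (E + 1) = kernel a E + kernel a (E + 1) := by
  have h0 := coe_exp_sub_one_ne_zero
  unfold kernel
  rw [← exp_mul_exp_eq_exp_add, rescale_one, RingHom.id_apply, coe_mul]
  have : ((exp ℂ : PowerSeries ℂ) : LaurentSeries ℂ) =
      ((exp ℂ - 1 : PowerSeries ℂ) : LaurentSeries ℂ) + 1 := by
    rw [coe_sub, coe_one]; ring
  rw [this]
  field_simp
  ring

theorem coeff_kernel_zero (a : ℂ) : (kernel a 0).coeff (-1) = 0 := by
  simp [kernel, coeff_coe]

/-- Since e^x is the derivative of f = e^x - 1, this is the residue of f'/f^{M+1}. It starts the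
induction by Pascal's rule. -/
theorem coeff_kernel_one (M : ℕ) : (kernel 1 (M + 1)).coeff (-1) = if M = 0 then 1 else 0 := by
  obtain ⟨U, hU, hX⟩ := exists_exp_sub_one_eq_X_mul
  have hU0 : constantCoeff U ≠ 0 := by simp [hU]
  have hUi : U * U⁻¹ = 1 := PowerSeries.mul_inv_cancel _ hU0
  have hd : d⁄dX ℂ (X * U) = exp ℂ := by
    rw [← hX]; ext n
    simp only [coeff_derivative, map_sub, coeff_exp, coeff_one, Nat.factorial_succ]
    have : ((n : ℂ) + 1) ≠ 0 := by exact_mod_cast Nat.succ_ne_zero n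
    have : ((n.factorial : ℂ)) ≠ 0 := by exact_mod_cast Nat.factorial_ne_zero n
    simp
    field_simp
  have key : kernel 1 (M + 1) = HahnSeries.single (-((M : ℤ) + 1)) (1 : ℂ) *
      ((d⁄dX ℂ (X * U) * U⁻¹ ^ (M + 1) : PowerSeries ℂ) : LaurentSeries ℂ) := by
    unfold kernel
    rw [div_eq_iff (pow_ne_zero _ coe_exp_sub_one_ne_zero), rescale_one, RingHom.id_apply, hd, hX]
    have h1 : (((X * U : PowerSeries ℂ)) : LaurentSeries ℂ) ^ (M + 1) =
        HahnSeries.single ((M : ℤ) + 1) (1 : ℂ) * ((U ^ (M + 1) : PowerSeries ℂ) :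
          LaurentSeries ℂ) := by
      rw [coe_mul, mul_pow, coe_X, HahnSeries.single_pow, coe_pow]; simp
    rw [h1]
    have h2 : HahnSeries.single (-((M : ℤ) + 1)) (1 : ℂ) * HahnSeries.single ((M : ℤ) + 1) (1 : ℂ)
        = 1 := by
      rw [HahnSeries.single_mul_single]; simp
    have h3 : ((exp ℂ * U⁻¹ ^ (M + 1) : PowerSeries ℂ) : LaurentSeries ℂ) *
        ((U ^ (M + 1) : PowerSeries ℂ) : LaurentSeries ℂ) =
        ((exp ℂ : PowerSeries ℂ) : LaurentSeries ℂ) := by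
      rw [← coe_mul, mul_assoc, ← mul_pow, mul_comm _ U, hUi, one_pow, mul_one]
    linear_combination (-((exp ℂ : PowerSeries ℂ) : LaurentSeries ℂ)) * h2 -
      (HahnSeries.single (-((M : ℤ) + 1)) (1 : ℂ) * HahnSeries.single ((M : ℤ) + 1) (1 : ℂ)) * h3
  rw [key, show (-1 : ℤ) = (M : ℤ) + -((M : ℤ) + 1) by ring, HahnSeries.coeff_single_mul_add,
    one_mul, LaurentSeries.coeff_coe_powerSeries, coeff_derivative_mul_inv_pow hU]

/-- `Res_x e^{(b + 1) x} / (e^x - 1)^{M + 1} = binom(b, M)`. -/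
theorem coeff_kernel_natCast_add_one (b M : ℕ) :
    (kernel ((b : ℂ) + 1) (M + 1)).coeff (-1) = (b.choose M : ℂ) := by
  induction b generalizing M with
  | zero =>
    rw [Nat.cast_zero, zero_add, coeff_kernel_one]
    cases M <;> simp
  | succ b ih =>
    rw [kernel_add_one, HahnSeries.coeff_add, Nat.cast_succ, ih]
    cases M with
    | zero => rw [coeff_kernel_zero]; simp
    | succ M => rw [ih, Nat.choose_succ_succ]; push_cast; ring

end VertexAlgebra

/-! ### Double series in x₁, x₂ and the substitution x₁ = x₂ e^x. -/

/-- A Vandermonde argument: the nodes p/T are distinct, so a Lagrange basis polynomial isolates one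
value of f as a combination of its moments. This recovers the coefficients of a double series from
its substitution. -/
theorem mem_of_forall_finsum_pow_smul_mem {W : Type*} [AddCommGroup W] [Module ℂ W] {T : ℕ}
    (hT : 0 < T) (S : Submodule ℂ W) {f : ℤ → W} (hf : f.HasFiniteSupport)
    (h : ∀ j : ℕ, ∑ᶠ p : ℤ, ((p : ℂ) / (T : ℂ)) ^ j • f p ∈ S) (p : ℤ) : f p ∈ S := by
  classical
  have hT0 : (T : ℂ) ≠ 0 := by exact_mod_cast hT.ne'
  set I : Finset ℤ := Set.Finite.toFinset hf with hI
  by_cases hp : p ∈ I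
  swap
  · have : f p = 0 := by
      by_contra h0
      exact hp ((Set.Finite.mem_toFinset hf).2 h0)
    rw [this]; exact S.zero_mem
  have hinj : Set.InjOn (fun q : ℤ => (q : ℂ) / (T : ℂ)) (I : Set ℤ) := by
    intro a _ b _ hab
    have := (div_left_inj' hT0).1 hab
    exact_mod_cast this
  have hj : ∀ j : ℕ, ∑ q ∈ I, ((q : ℂ) / (T : ℂ)) ^ j • f q ∈ S := by
    intro j
    rw [← finsum_eq_sum_of_support_subset]
    · exact h j
    · intro q hq
      refine Finset.mem_coe.2 ((Set.Finite.mem_toFinset hf).2 fun h0 => hq ?_)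
      simp [h0]
  have key : f p = ∑ q ∈ I, (Lagrange.basis I (fun q : ℤ => (q : ℂ) / (T : ℂ)) p).eval
      ((q : ℂ) / (T : ℂ)) • f q := by
    rw [Finset.sum_eq_single p]
    · rw [Lagrange.eval_basis_self hinj hp, one_smul]
    · intro q hq hqp
      rw [Lagrange.eval_basis_of_ne (v := fun q : ℤ => (q : ℂ) / (T : ℂ)) hqp.symm hq, zero_smul]
    · exact fun h => absurd hp h
  rw [key]
  simp_rw [Polynomial.eval_eq_sum_range, Finset.sum_smul]
  rw [Finset.sum_comm]
  refine S.sum_mem fun j _ => ?_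
  simp_rw [mul_smul, ← Finset.smul_sum]
  exact S.smul_mem _ (hj j)

/-- A double series `∑ X p q x₁^{p/T} x₂^{q/T}` is multiplied by `x₁ - x₂`. -/
def mulSub {W : Type*} [AddCommGroup W] [Module ℂ W] (T : ℕ) : Module.End ℂ (ℤ → ℤ → W) where
  toFun X p q := X (p - T) q - X p (q - T)
  map_add' X Y := by ext p q; simp only [Pi.add_apply]; abel
  map_smul' c X := by ext p q; simp [smul_sub]

/-- The double series lies in `W((x₁^{1/T}, x₂^{1/T}))`. -/
def IsLowerTruncated {W : Type*} [AddCommGroup W] (X : ℤ → ℤ → W) : Prop :=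
  ∃ N : ℤ, ∀ p q : ℤ, p < N ∨ q < N → X p q = 0

/-- The coefficient of `x₂^{s/T}` in `X(x₂ e^x, x₂)`, paired with the functional `l`. -/
noncomputable def substExp {W : Type*} [AddCommGroup W] [Module ℂ W] (T : ℕ) (l : Module.Dual ℂ W)
    (s : ℤ) (X : ℤ → ℤ → W) : PowerSeries ℂ :=
  ∑ᶠ p : ℤ, l (X p (s - p)) • PowerSeries.rescale ((p : ℂ) / (T : ℂ)) (PowerSeries.exp ℂ)

section

variable {W : Type*} [AddCommGroup W] [Module ℂ W] {T : ℕ} {X Y : ℤ → ℤ → W}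

theorem mulSub_apply (p q : ℤ) : mulSub T X p q = X (p - T) q - X p (q - T) := rfl

theorem mulSub_pow_succ_apply (k : ℕ) (p q : ℤ) :
    (mulSub T ^ (k + 1)) X p q =
      (mulSub T ^ k) X (p - T) q - (mulSub T ^ k) X p (q - T) := by
  rw [pow_succ']; rfl

theorem mulSub_pow_apply (k : ℕ) (p q : ℤ) :
    (mulSub T ^ k) X p q = ∑ i ∈ Finset.range (k + 1), ((-1 : ℂ) ^ i * (Nat.choose k i : ℂ)) •
      X (p - T * (k - i)) (q - T * i) := by
  induction k generalizing p q with
  | zero => simp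
  | succ k ih =>
    have h1 : ∑ i ∈ Finset.range (k + 1), ((-1 : ℂ) ^ i * (Nat.choose k i : ℂ)) •
        X (p - T - T * (k - i)) (q - T * i) = ∑ i ∈ Finset.range (k + 1 + 1),
        ((-1 : ℂ) ^ i * (Nat.choose k i : ℂ)) • X (p - T * ((k + 1 : ℕ) - i)) (q - T * i) := by
      rw [Finset.sum_range_succ _ (k + 1), Nat.choose_succ_self]
      simp only [Nat.cast_zero, mul_zero, zero_smul, add_zero]
      refine Finset.sum_congr rfl fun i _ => ?_
      congr 2
      push_cast; ring
    rw [mulSub_pow_succ_apply, ih, ih, h1, Finset.sum_range_succ' _ (k + 1),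
      Finset.sum_range_succ' _ (k + 1), add_sub_right_comm, ← Finset.sum_sub_distrib]
    congr 1
    · refine Finset.sum_congr rfl fun i _ => ?_
      have e1 : p - (T : ℤ) * (((k + 1 : ℕ) : ℤ) - ((i + 1 : ℕ) : ℤ)) = p - T * (k - i) := by
        push_cast; ring
      have e2 : q - (T : ℤ) * ((i + 1 : ℕ) : ℤ) = q - T - T * i := by push_cast; ring
      rw [e1, e2, ← sub_smul, Nat.choose_succ_succ]
      congr 1
      push_cast; ring
    · simp

/-- A coefficient of the product involves only coefficients of X with indices lowered by multiples
of T. The region Q is later a half-plane or a union of congruence classes. -/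
theorem mulSub_pow_apply_eq_zero {Q : ℤ → ℤ → Prop}
    (hQ : ∀ p q, Q p q → Q (p - T) q ∧ Q p (q - T)) (h : ∀ p q, Q p q → X p q = 0) (k : ℕ)
    (p q : ℤ) (hpq : Q p q) : (mulSub T ^ k) X p q = 0 := by
  induction k generalizing p q with
  | zero => exact h p q hpq
  | succ k ih =>
    rw [mulSub_pow_succ_apply, ih _ _ (hQ p q hpq).1, ih _ _ (hQ p q hpq).2, sub_zero]

/-- Division by x₁ - x₂ is possible because X is bounded below in x₂: the coefficient at (p, q) is
that of the product at (p + T, q) plus that of X at (p + T, q - T), and lowering q ends in the zero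
region. -/
theorem mem_of_mulSub_pow_apply_mem (S : Submodule ℂ W) (hT : 0 < T) {N : ℤ}
    (hN : ∀ p q, q < N → X p q = 0) (k : ℕ) (h : ∀ p q, (mulSub T ^ k) X p q ∈ S) (p q : ℤ) :
    X p q ∈ S := by
  induction k with
  | zero => exact h p q
  | succ k ih =>
    refine ih fun p q => ?_
    have hz : ∀ p q, q < N → (mulSub T ^ k) X p q = 0 := fun p q hq =>
      mulSub_pow_apply_eq_zero (Q := fun _ q => q < N) (fun _ _ h => ⟨h, by omega⟩) hN k p q hq
    have main : ∀ (d : ℕ) (p q : ℤ), q < N + d → (mulSub T ^ k) X p q ∈ S := by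
      intro d
      induction d with
      | zero => intro p q hq; rw [hz p q (by simpa using hq)]; exact S.zero_mem
      | succ d ihd =>
        intro p q hq
        have h1 := h (p + T) q
        rw [mulSub_pow_succ_apply, add_sub_cancel_right] at h1
        have h2 := ihd (p + T) (q - T) (by push_cast at hq; omega)
        simpa using S.add_mem h1 h2
    exact main (q - N + 1).toNat p q (by omega)

theorem mulSub_pow_flip (k : ℕ) :
    (mulSub T ^ k) (fun p q => X q p) = fun p q => (-1 : ℂ) ^ k • (mulSub T ^ k) X q p := by
  induction k with
  | zero => simp
  | succ k ih =>
    ext p q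
    rw [mulSub_pow_succ_apply, mulSub_pow_succ_apply, ih, pow_succ, mul_smul, neg_one_smul,
      neg_sub, smul_sub]

theorem IsLowerTruncated.mulSub (h : IsLowerTruncated X) : IsLowerTruncated (mulSub T X) := by
  obtain ⟨N, hN⟩ := h
  refine ⟨N, fun p q hpq => ?_⟩
  rw [mulSub_apply, hN _ _ (by omega), hN _ _ (by omega), sub_zero]

theorem IsLowerTruncated.flip {W : Type*} [AddCommGroup W] {X : ℤ → ℤ → W}
    (h : IsLowerTruncated X) : IsLowerTruncated fun p q => X q p := by
  obtain ⟨N, hN⟩ := h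
  exact ⟨N, fun p q hpq => hN _ _ hpq.symm⟩

theorem IsLowerTruncated.hasFiniteSupport {W : Type*} [AddCommGroup W] {X : ℤ → ℤ → W}
    (h : IsLowerTruncated X) (s : ℤ) :
    (fun p => X p (s - p)).HasFiniteSupport := by
  obtain ⟨N, hN⟩ := h
  refine (Set.finite_Icc N (s - N)).subset fun p hp => ?_
  by_contra hc
  rw [Set.mem_Icc] at hc
  exact hp (hN _ _ (by omega))

theorem IsLowerTruncated.hasFiniteSupport_smul {M : Type*} [AddCommGroup M] [Module ℂ M]
    (h : IsLowerTruncated X) (l : Module.Dual ℂ W) (s : ℤ) (e : ℤ → M) :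
    (fun p => l (X p (s - p)) • e p).HasFiniteSupport :=
  (h.hasFiniteSupport s).subset fun p hp h0 => hp (by
    have : X p (s - p) = 0 := h0
    simp [this])

theorem coeff_substExp (h : IsLowerTruncated X) (l : Module.Dual ℂ W) (s : ℤ) (j : ℕ) :
    PowerSeries.coeff j (substExp T l s X) =
      ∑ᶠ p : ℤ, l (X p (s - p)) * (((p : ℂ) / (T : ℂ)) ^ j / (j.factorial : ℂ)) := by
  unfold substExp
  rw [map_finsum _ (h.hasFiniteSupport_smul l s _)]
  refine finsum_congr fun p => ?_
  simp [PowerSeries.coeff_rescale, PowerSeries.coeff_exp, div_eq_mul_inv]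

/-- Under the substitution x₁ - x₂ becomes x₂ (e^x - 1); the factor x₂ accounts for the shift of s
by T. -/
theorem substExp_mulSub (hT : 0 < T) (h : IsLowerTruncated X) (l : Module.Dual ℂ W) (s : ℤ) :
    substExp T l s (mulSub T X) = (PowerSeries.exp ℂ - 1) * substExp T l (s - T) X := by
  have hT0 : (T : ℂ) ≠ 0 := by exact_mod_cast hT.ne'
  have h1 : PowerSeries.exp ℂ * substExp T l (s - T) X =
      ∑ᶠ p : ℤ, l (X (p - T) (s - p)) •
        PowerSeries.rescale ((p : ℂ) / (T : ℂ)) (PowerSeries.exp ℂ) := by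
    unfold substExp
    rw [mul_finsum]
    refine Eq.trans (finsum_congr fun p => ?_) (finsum_comp_equiv (Equiv.addRight (T : ℤ)))
    rw [Equiv.coe_addRight, add_sub_cancel_right, mul_smul_comm, show s - (p + T) = s - T - p by ring]
    congr 1
    have : ((p + T : ℤ) : ℂ) / (T : ℂ) = 1 + (p : ℂ) / (T : ℂ) := by
      push_cast; field_simp; ring
    rw [this, ← PowerSeries.exp_mul_exp_eq_exp_add, PowerSeries.rescale_one, RingHom.id_apply]
  have hs : (fun p => l (X (p - T) (s - p)) •
      PowerSeries.rescale ((p : ℂ) / (T : ℂ)) (PowerSeries.exp ℂ)).HasFiniteSupport := by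
    have h' : IsLowerTruncated fun p q => X (p - T) q := by
      obtain ⟨N, hN⟩ := h
      exact ⟨N, fun p q hpq => hN _ _ (by omega)⟩
    exact h'.hasFiniteSupport_smul l s _
  rw [sub_mul, one_mul, h1]
  unfold substExp
  rw [← finsum_sub_distrib hs (h.hasFiniteSupport_smul l (s - T) _)]
  refine finsum_congr fun p => ?_
  rw [mulSub_apply, map_sub, sub_smul, show s - p - (T : ℤ) = s - T - p by ring]

/-- The reindexing p ↦ s - p turns e^{px/T} into e^{sx/T} e^{-px/T}. -/
theorem substExp_flip (h : IsLowerTruncated X) (l : Module.Dual ℂ W) (s : ℤ) :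
    substExp T l s (fun p q => X q p) = PowerSeries.rescale ((s : ℂ) / (T : ℂ)) (PowerSeries.exp ℂ) *
      PowerSeries.rescale (-1) (substExp T l s X) := by
  unfold substExp
  rw [map_finsum _ (h.hasFiniteSupport_smul l s _), mul_finsum,
    ← finsum_comp_equiv (Equiv.subLeft s)]
  · refine finsum_congr fun p => ?_
    rw [Equiv.subLeft_apply, sub_sub_cancel]
    have hsm : ∀ (c : ℂ) (f : PowerSeries ℂ),
        PowerSeries.rescale (-1) (c • f) = c • PowerSeries.rescale (-1) f := fun c f => by
      ext j; simp [PowerSeries.coeff_rescale]; ring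
    rw [hsm, PowerSeries.rescale_rescale, mul_smul_comm, PowerSeries.exp_mul_exp_eq_exp_add]
    congr 3
    push_cast; ring

theorem eq_of_substExp_eq (hT : 0 < T) (hX : IsLowerTruncated X) (hY : IsLowerTruncated Y)
    (h : ∀ l s, substExp T l s X = substExp T l s Y) : X = Y := by
  ext p q
  rw [← sub_eq_zero, ← Module.forall_dual_apply_eq_zero_iff ℂ]
  intro l
  have hf : ∀ (Z : ℤ → ℤ → W), IsLowerTruncated Z →
      (fun r => l (Z r (p + q - r))).HasFiniteSupport := fun Z hZ => by
    simpa using hZ.hasFiniteSupport_smul l (p + q) (fun _ => (1 : ℂ))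
  have key := mem_of_forall_finsum_pow_smul_mem hT (⊥ : Submodule ℂ ℂ)
    (f := fun r => l (X r (p + q - r)) - l (Y r (p + q - r)))
    ((hf X hX).sub (hf Y hY)) (fun j => ?_) p
  · simpa using key
  · have h1 := congrArg (PowerSeries.coeff j) (h l (p + q))
    have hs := fun (Z : ℤ → ℤ → W) (hZ : IsLowerTruncated Z) => hZ.hasFiniteSupport_smul l (p + q)
      fun r : ℤ => ((r : ℂ) / (T : ℂ)) ^ j / (j.factorial : ℂ)
    simp only [smul_eq_mul] at hs
    rw [coeff_substExp hX, coeff_substExp hY, ← sub_eq_zero,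
      ← finsum_sub_distrib (hs X hX) (hs Y hY)] at h1
    have h2 := congrArg (fun z => (j.factorial : ℂ) * z) h1
    simp only [mul_zero] at h2
    rw [mul_finsum] at h2
    · rw [Submodule.mem_bot, ← h2]
      refine finsum_congr fun r => ?_
      have : (j.factorial : ℂ) ≠ 0 := by exact_mod_cast j.factorial_ne_zero
      rw [smul_eq_mul]; field_simp

end

/-! ### Skew symmetry in the vertex algebra. -/

namespace VertexAlgebra

variable {V : Type*} [AddCommGroup V] [Module ℂ V] (A : VertexAlgebra V)

/-- This is the Jacobi identity on the vacuum at indices (m, -1, 0): the first sum dies, the second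
keeps one term, and the third has signs binom(-1, i) = (-1)^i. The vectors a_{-1-i} 𝟏 play the role
of 𝒟^i a / i!, so no powers of 𝒟 are needed. -/
theorem skew_symmetry (u v : V) (m : ℤ) (d : ℕ) (h : ∀ n : ℤ, m + d < n → A.Y n u v = 0) :
    A.Y m v u = ∑ i ∈ Finset.range (d + 1), ((-1 : ℂ) ^ (m + 1 + i)) •
      A.Y (-1 - i) (A.Y (m + i) u v) A.vac := by
  have hJ := A.jacobi u v A.vac m (-1) 0
  have hz : ∀ i : ℕ, A.Y (0 + i) v A.vac = 0 := fun i => by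
    rw [A.vac_right _ _ (by omega), if_neg (by omega)]
  have h1 : ∑ᶠ i : ℕ, ((-1 : ℂ) ^ i * (Ring.choose m i : ℤ)) •
      A.Y (m + -1 - i) u (A.Y (0 + i) v A.vac) = 0 := by
    simp only [hz, map_zero, smul_zero, finsum_zero]
  have h2 : ∑ᶠ i : ℕ, ((-1 : ℂ) ^ m * (-1 : ℂ) ^ i * (Ring.choose m i : ℤ)) •
      A.Y (m + 0 - i) v (A.Y (-1 + i) u A.vac) = (-1 : ℂ) ^ m • A.Y m v u := by
    rw [finsum_eq_single _ 0]
    · simp [A.vac_right]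
    · intro i hi
      rw [A.vac_right _ _ (by omega), if_neg (by omega), map_zero, smul_zero]
  have h3 : ∑ᶠ i : ℕ, ((Ring.choose (-1 : ℤ) i : ℤ) : ℂ) •
      A.Y (-1 + 0 - i) (A.Y (m + i) u v) A.vac = ∑ i ∈ Finset.range (d + 1),
      ((-1 : ℂ) ^ i) • A.Y (-1 - i) (A.Y (m + i) u v) A.vac := by
    rw [finsum_eq_sum_of_support_subset (s := Finset.range (d + 1))]
    · refine Finset.sum_congr rfl fun i _ => ?_
      rw [Ring.choose_neg', Ring.multichoose_one, add_zero]
      congr 1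
      simp [Int.negOnePow_def, Units.smul_def]
    · intro i hi
      simp only [Finset.coe_range, Set.mem_Iio]
      by_contra hc
      refine hi ?_
      simp only
      rw [h _ (by omega)]
      simp
  rw [h1, h2, h3, zero_sub] at hJ
  have h4 := congrArg (fun z => -((-1 : ℂ) ^ m • z)) hJ
  simp only [smul_neg, neg_neg, smul_smul] at h4
  rw [← mul_zpow] at h4
  simp only [mul_neg, mul_one, neg_neg, one_zpow, one_smul] at h4
  rw [h4, Finset.smul_sum, ← Finset.sum_neg_distrib]
  refine Finset.sum_congr rfl fun i _ => ?_
  rw [smul_smul, ← neg_smul]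
  congr 1
  rw [zpow_add₀ (by norm_num), zpow_add₀ (by norm_num)]
  simp

end VertexAlgebra

section

variable {W : Type*} [AddCommGroup W] [Module ℂ W] {T : ℕ} {X : ℤ → ℤ → W}

theorem IsLowerTruncated.mulSub_pow (h : IsLowerTruncated X) (k : ℕ) :
    IsLowerTruncated ((_root_.mulSub T ^ k) X) := by
  induction k with
  | zero => exact h
  | succ k ih => rw [pow_succ']; exact ih.mulSub

theorem substExp_mulSub_pow (hT : 0 < T) (h : IsLowerTruncated X) (l : Module.Dual ℂ W) (k : ℕ)
    (s : ℤ) : substExp T l s ((mulSub T ^ k) X) =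
      (PowerSeries.exp ℂ - 1) ^ k * substExp T l (s - T * k) X := by
  induction k generalizing s with
  | zero => simp
  | succ k ih =>
    rw [pow_succ', Module.End.mul_apply, substExp_mulSub hT (h.mulSub_pow k), ih, pow_succ',
      mul_assoc]
    congr 3
    push_cast; ring

end

/-! ### Weak associativity as an identity of scalar power series, and weak commutativity. -/

namespace TwistedPhiModule

variable {V : Type*} [AddCommGroup V] [Module ℂ V] {A : VertexAlgebra V} {g : V ≃ₗ[ℂ] V} {T : ℕ}
  {W : Type*} [AddCommGroup W] [Module ℂ W] (M : TwistedPhiModule A g T W)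

/-- The coefficients of `Y_W(u, x₁) Y_W(v, x₂) w`. -/
def prodCoeff (u v : V) (w : W) (p q : ℤ) : W := M.coeff p u (M.coeff q v w)

/-- The coefficient of `x₂^{s/T}` in `x^N Y_W(Y(u, x) v, x₂) w`, paired with `l`. -/
noncomputable def iterSeries (l : Module.Dual ℂ W) (N : ℕ) (s : ℤ) (u v : V) (w : W) :
    PowerSeries ℂ :=
  PowerSeries.mk fun j => l (M.coeff s (A.Y (N - 1 - j) u v) w)

theorem exists_assoc (u v : V) : ∃ k : ℕ, ∀ w : W,
    IsLowerTruncated ((mulSub T ^ k) (M.prodCoeff u v w)) ∧ ∀ j s : ℤ,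
      (∑ᶠ i : ℕ, (PowerSeries.coeff i ((PowerSeries.exp ℂ - 1) ^ k) : ℂ) •
        M.coeff (s - T * k) (A.Y (i - j - 1) u v) w) =
      if 0 ≤ j then
        ∑ᶠ p : ℤ, (((p : ℂ) / (T : ℂ)) ^ j.toNat / (j.toNat.factorial : ℂ)) •
          (mulSub T ^ k) (M.prodCoeff u v w) p (s - p)
      else 0 := by
  obtain ⟨k, hk⟩ := M.assoc u v
  refine ⟨k, fun w => ?_⟩
  obtain ⟨F, hF, hN, hs⟩ := hk w
  have : F = (mulSub T ^ k) (M.prodCoeff u v w) := by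
    ext p q
    rw [hF, mulSub_pow_apply]; rfl
  subst this
  exact ⟨hN, hs⟩

/-- Multiplying by X^N clears the pole of Y(u, x) v, and pairing with l makes the identity one in
the domain of scalar power series, where factors cancel. Any larger exponent K works too, since the
extra powers of x₁ - x₂ contribute the same factor on both sides. -/
theorem exists_forall_substExp_eq (hT : 0 < T) (u v : V) : ∃ k : ℕ, ∀ K ≥ k, ∀ w : W,
    IsLowerTruncated ((mulSub T ^ K) (M.prodCoeff u v w)) ∧
    ∀ N : ℕ, (∀ n : ℤ, N ≤ n → A.Y n u v = 0) → ∀ (l : Module.Dual ℂ W) (s : ℤ),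
      PowerSeries.X ^ N * substExp T l s ((mulSub T ^ K) (M.prodCoeff u v w)) =
        (PowerSeries.exp ℂ - 1) ^ K * M.iterSeries l N (s - T * K) u v w := by
  obtain ⟨k, hk⟩ := M.exists_assoc u v
  refine ⟨k, fun K hK w => ?_⟩
  obtain ⟨hF, hs⟩ := hk w
  obtain ⟨d, rfl⟩ := Nat.exists_eq_add_of_le hK
  rw [add_comm k d, pow_add, Module.End.mul_apply]
  refine ⟨hF.mulSub_pow d, fun N hN l s => ?_⟩
  rw [substExp_mulSub_pow hT hF, mul_left_comm, pow_add, mul_assoc]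
  congr 1
  have e : s - (T : ℤ) * ((d + k : ℕ) : ℤ) = s - T * d - T * k := by push_cast; ring
  rw [e]
  generalize s - (T : ℤ) * d = s
  ext m
  have h := congrArg l (hs (m - N) s)
  have hfin : (fun i : ℕ => (PowerSeries.coeff i ((PowerSeries.exp ℂ - 1) ^ k) : ℂ) •
      M.coeff (s - T * k) (A.Y (i - (m - N) - 1) u v) w).support ⊆ Finset.range (m + 1) := by
    intro i hi
    simp only [Finset.coe_range, Set.mem_Iio]
    by_contra hc
    refine hi ?_
    simp only
    rw [hN _ (by omega)]
    simp
  rw [finsum_eq_sum_of_support_subset _ hfin, map_sum] at h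
  rw [PowerSeries.coeff_X_pow_mul', PowerSeries.coeff_mul,
    Finset.Nat.sum_antidiagonal_eq_sum_range_succ_mk]
  have h1 : ∑ i ∈ Finset.range m.succ, (PowerSeries.coeff i ((PowerSeries.exp ℂ - 1) ^ k) : ℂ) *
      PowerSeries.coeff (m - i) (M.iterSeries l N (s - T * k) u v w) =
      l (if (0 : ℤ) ≤ m - N then
        ∑ᶠ p : ℤ, (((p : ℂ) / (T : ℂ)) ^ ((m : ℤ) - N).toNat / (((m : ℤ) - N).toNat.factorial : ℂ)) •
          (mulSub T ^ k) (M.prodCoeff u v w) p (s - p)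
      else 0) := by
    rw [← h]
    refine Finset.sum_congr rfl fun i hi => ?_
    rw [Finset.mem_range] at hi
    rw [iterSeries, PowerSeries.coeff_mk, map_smul, smul_eq_mul]
    rw [show (N : ℤ) - 1 - ((m - i : ℕ) : ℤ) = i - (m - N) - 1 by omega]
  rw [h1]
  by_cases hm : N ≤ m
  · rw [if_pos hm, if_pos (by omega), coeff_substExp hF, map_finsum]
    · refine finsum_congr fun p => ?_
      rw [map_smul, smul_eq_mul, mul_comm, show ((m : ℤ) - N).toNat = m - N by omega]
    · refine (hF.hasFiniteSupport s).subset fun p hp h0 => hp ?_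
      simp only at h0 ⊢
      rw [h0, smul_zero]
  · rw [if_neg hm, if_neg (by omega), map_zero]

/-- `Y_W(Y(a, x) 𝟏, x₂) = Y_W(a, x₂ e^x)`. -/
theorem coeff_Y_vac (hT : 0 < T) (a : V) (s : ℤ) (i : ℕ) (w : W) :
    M.coeff s (A.Y (-1 - i) a A.vac) w =
      (((s : ℂ) / (T : ℂ)) ^ i / (i.factorial : ℂ)) • M.coeff s a w := by
  obtain ⟨K, hK⟩ := M.exists_forall_substExp_eq hT a A.vac
  have hX : IsLowerTruncated (M.prodCoeff a A.vac w) := by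
    obtain ⟨N, hN⟩ := M.trunc a w
    refine ⟨min N 0, fun p q hpq => ?_⟩
    rw [prodCoeff, M.vac]
    rcases hpq with hp | hq
    · split_ifs
      · exact hN _ (by omega)
      · exact map_zero _
    · rw [if_neg (by omega), map_zero]
  rw [← sub_eq_zero, ← Module.forall_dual_apply_eq_zero_iff ℂ]
  intro l
  -- N = 0 suffices since a_n 𝟏 = 0 for n ≥ 0. The product with Y_W(𝟏, x₂) = id is itself lower
  -- truncated, so (e^x - 1)^K can be pulled out and cancelled; s is raised by T K to absorb x₂^K.
  have h1 := (hK K le_rfl w).2 0 (fun n hn => by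
    rw [A.vac_right _ _ (by push_cast at hn; omega), if_neg (by push_cast at hn; omega)]) l
    (s + T * K)
  rw [substExp_mulSub_pow hT hX, pow_zero, one_mul, add_sub_cancel_right] at h1
  have h2 := congrArg (PowerSeries.coeff i)
    (mul_left_cancel₀ (pow_ne_zero _ PowerSeries.exp_sub_one_ne_zero) h1)
  rw [coeff_substExp hX, iterSeries, PowerSeries.coeff_mk, finsum_eq_single _ s] at h2
  · rw [map_sub, sub_eq_zero, map_smul, smul_eq_mul, mul_comm]
    simp only [prodCoeff, M.vac, sub_self, if_true] at h2
    rw [h2]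
    simp
  · intro p hp
    rw [prodCoeff, M.vac, if_neg (by omega)]
    simp

/-- Skew symmetry says Y(v, x) u = e^{x𝒟} Y(u, -x) v, and on the module e^{x𝒟} multiplies the
coefficient of x₂^{s/T} by e^{sx/T} (`coeff_Y_vac`). The sign (-1)^N comes from x^N. -/
theorem iterSeries_swap (hT : 0 < T) (l : Module.Dual ℂ W) (N : ℕ) (s : ℤ) (u v : V) (w : W)
    (hN : ∀ n : ℤ, N ≤ n → A.Y n u v = 0) :
    M.iterSeries l N s v u w = (-1 : ℂ) ^ N • (PowerSeries.rescale ((s : ℂ) / (T : ℂ))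
      (PowerSeries.exp ℂ) * PowerSeries.rescale (-1) (M.iterSeries l N s u v w)) := by
  ext j
  rw [iterSeries, PowerSeries.coeff_mk, A.skew_symmetry u v (N - 1 - j) j
    (fun n hn => hN n (by omega)), map_sum, LinearMap.sum_apply, map_sum, PowerSeries.coeff_smul,
    PowerSeries.coeff_mul, Finset.Nat.sum_antidiagonal_eq_sum_range_succ_mk, Finset.smul_sum]
  refine Finset.sum_congr rfl fun i hi => ?_
  rw [Finset.mem_range] at hi
  obtain ⟨d, rfl⟩ : ∃ d, j = i + d := ⟨j - i, by omega⟩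
  rw [map_smul, LinearMap.smul_apply, M.coeff_Y_vac hT, map_smul, map_smul]
  simp only [PowerSeries.coeff_rescale, PowerSeries.coeff_exp, iterSeries, PowerSeries.coeff_mk,
    Nat.add_sub_cancel_left, smul_eq_mul, map_div₀, map_one, map_natCast]
  have e1 : (N : ℤ) - 1 - ((i + d : ℕ) : ℤ) + i = N - 1 - d := by push_cast; ring
  have e2 : (-1 : ℂ) ^ ((N : ℤ) - 1 - ((i + d : ℕ) : ℤ) + 1 + i) = (-1) ^ N * (-1) ^ d := by
    rw [show (N : ℤ) - 1 - ((i + d : ℕ) : ℤ) + 1 + i = (N : ℤ) - d by push_cast; ring,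
      zpow_sub₀ (by norm_num), zpow_natCast, zpow_natCast, div_eq_mul_inv, ← inv_pow]
    norm_num
  rw [e1, e2]
  ring

/-- Weak commutativity, which follows from weak associativity and skew symmetry. -/
theorem exists_mulSub_pow_prodCoeff_eq_flip (hT : 0 < T) (u v : V) : ∃ k : ℕ, ∀ K ≥ k, ∀ w : W,
    (mulSub T ^ K) (M.prodCoeff u v w) = (mulSub T ^ K) (fun p q => M.prodCoeff v u w q p) := by
  obtain ⟨k₁, h₁⟩ := M.exists_forall_substExp_eq hT u v
  obtain ⟨k₂, h₂⟩ := M.exists_forall_substExp_eq hT v u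
  refine ⟨max k₁ k₂, fun K hK w => ?_⟩
  obtain ⟨hX, hX'⟩ := h₁ K (le_trans (le_max_left _ _) hK) w
  obtain ⟨hY, hY'⟩ := h₂ K (le_trans (le_max_right _ _) hK) w
  rw [mulSub_pow_flip (X := M.prodCoeff v u w)]
  have hZ : IsLowerTruncated fun p q => (-1 : ℂ) ^ K • (mulSub T ^ K) (M.prodCoeff v u w) q p := by
    obtain ⟨N, hN⟩ := hY.flip
    exact ⟨N, fun p q hpq => (congrArg ((-1 : ℂ) ^ K • ·) (hN p q hpq)).trans (smul_zero _)⟩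
  -- Both sides are lower truncated, so it is enough to compare their substitutions. These agree
  -- because (e^{-x} - 1)^K = (-1)^K e^{-Kx} (e^x - 1)^K, which `hexp` and `hs` below encode.
  refine eq_of_substExp_eq hT hX hZ fun l s => ?_
  obtain ⟨N₁, hN₁⟩ := A.trunc u v
  obtain ⟨N₂, hN₂⟩ := A.trunc v u
  set N : ℕ := (max N₁ N₂).toNat
  have hN1 : ∀ n : ℤ, (N : ℤ) ≤ n → A.Y n u v = 0 := fun n hn => hN₁ n (by omega)
  have hN2 : ∀ n : ℤ, (N : ℤ) ≤ n → A.Y n v u = 0 := fun n hn => hN₂ n (by omega)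
  have hsm : substExp T l s (fun p q => (-1 : ℂ) ^ K • (mulSub T ^ K) (M.prodCoeff v u w) q p) =
      substExp T ((-1 : ℂ) ^ K • l) s (fun p q => (mulSub T ^ K) (M.prodCoeff v u w) q p) := by
    unfold substExp
    refine finsum_congr fun p => ?_
    rw [map_smul, LinearMap.smul_apply]
  have hsl : ∀ Z : ℤ → ℤ → W, substExp T ((-1 : ℂ) ^ K • l) s Z =
      (-1 : ℂ) ^ K • substExp T l s Z := fun Z => by
    unfold substExp
    rw [smul_finsum]
    refine finsum_congr fun p => ?_
    rw [LinearMap.smul_apply, smul_assoc]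
  apply mul_left_cancel₀ (pow_ne_zero N (PowerSeries.X_ne_zero (R := ℂ)))
  rw [hX' N hN1, hsm, hsl, substExp_flip hY, M.iterSeries_swap hT l N _ v u w hN2]
  have h3 := congrArg (PowerSeries.rescale (-1 : ℂ)) (hY' N hN2 l s)
  have hXr : PowerSeries.rescale (-1 : ℂ) (PowerSeries.X ^ N) =
      (-1 : PowerSeries ℂ) ^ N * PowerSeries.X ^ N := by
    rw [map_pow, PowerSeries.rescale_X, mul_pow]
    simp
  have hexp : PowerSeries.rescale (-1 : ℂ) (PowerSeries.exp ℂ - 1) =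
      -(PowerSeries.rescale (-1 : ℂ) (PowerSeries.exp ℂ) * (PowerSeries.exp ℂ - 1)) := by
    have := PowerSeries.exp_mul_exp_eq_exp_add (-1 : ℂ) 1
    simp only [neg_add_cancel, PowerSeries.rescale_one, RingHom.id_apply] at this
    rw [map_sub, map_one, mul_sub, this]
    simp
  have hs : PowerSeries.rescale ((s : ℂ) / (T : ℂ)) (PowerSeries.exp ℂ) *
      PowerSeries.rescale (-1 : ℂ) (PowerSeries.exp ℂ) ^ K =
      PowerSeries.rescale (((s - T * K : ℤ) : ℂ) / (T : ℂ)) (PowerSeries.exp ℂ) := by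
    have hT0 : (T : ℂ) ≠ 0 := by exact_mod_cast hT.ne'
    rw [← map_pow, PowerSeries.exp_pow_eq_rescale_exp, PowerSeries.rescale_rescale,
      PowerSeries.exp_mul_exp_eq_exp_add]
    congr 2
    push_cast; field_simp; ring
  rw [map_mul, map_mul, hXr, map_pow, hexp, neg_pow (_ * _), mul_pow (PowerSeries.rescale _ _)] at h3
  simp only [PowerSeries.smul_eq_C_mul, map_pow, map_neg, map_one]
  have hsq : ∀ m : ℕ, ((-1 : PowerSeries ℂ) ^ m) * (-1) ^ m = 1 := fun m => by
    rw [← mul_pow]; simp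
  generalize PowerSeries.rescale (-1 : ℂ) (substExp T l s ((mulSub T ^ K) (M.prodCoeff v u w))) = S
    at *
  generalize PowerSeries.rescale (-1 : ℂ) (M.iterSeries l N (s - T * K) v u w) = P at *
  rw [← hs]
  generalize PowerSeries.rescale ((s : ℂ) / (T : ℂ)) (PowerSeries.exp ℂ) = e1 at *
  generalize PowerSeries.rescale (-1 : ℂ) (PowerSeries.exp ℂ) ^ K = e2 at *
  linear_combination (-(-1) ^ N * (-1) ^ K * e1) * h3 +
    (PowerSeries.X ^ N * e1 * S * (-1) ^ K) * hsq N -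
    ((-1) ^ N * e1 * e2 * (PowerSeries.exp ℂ - 1) ^ K * P) * hsq K

end TwistedPhiModule

/-! ### Modes of residues, and submodules generated by one vector. -/

namespace TwistedPhiModule

variable {V : Type*} [AddCommGroup V] [Module ℂ V] {A : VertexAlgebra V} {g : V ≃ₗ[ℂ] V} {T : ℕ}
  {W : Type*} [AddCommGroup W] [Module ℂ W] (M : TwistedPhiModule A g T W)

theorem coeff_res_eq_coeff_mul (f : LaurentSeries ℂ) (l : Module.Dual ℂ W) (N : ℕ) (s : ℤ)
    (u v : V) (w : W) (hN : ∀ n : ℤ, N ≤ n → A.Y n u v = 0) :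
    l (M.coeff s (A.res f u v) w) = (f * (HahnSeries.single (-(N : ℤ)) (1 : ℂ) *
      ((M.iterSeries l N s u v w : PowerSeries ℂ) : LaurentSeries ℂ))).coeff (-1) := by
  classical
  set h : LaurentSeries ℂ := HahnSeries.single (-(N : ℤ)) (1 : ℂ) *
      ((M.iterSeries l N s u v w : PowerSeries ℂ) : LaurentSeries ℂ) with hh
  have hcoeff : ∀ i : ℤ, h.coeff (-1 - i) = l (M.coeff s (A.Y i u v) w) := by
    intro i
    rw [hh, show -1 - i = (N - 1 - i) + -(N : ℤ) by ring, HahnSeries.coeff_single_mul_add, one_mul,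
      PowerSeries.coeff_coe]
    split_ifs with hi
    · rw [hN i (by omega)]; simp
    · rw [iterSeries, PowerSeries.coeff_mk]
      rw [show (N : ℤ) - 1 - (((N : ℤ) - 1 - i).natAbs : ℤ) = i by omega]
  have hfin : (fun i : ℤ => f.coeff i • A.Y i u v).HasFiniteSupport := by
    refine (Set.finite_Icc f.order N).subset fun i hi => ?_
    by_contra hc
    rw [Set.mem_Icc, not_and_or, not_le, not_le] at hc
    refine hi ?_
    rcases hc with hc | hc
    · simp [HahnSeries.coeff_eq_zero_of_lt_order hc]
    · simp [hN i hc.le]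
  have h1 : l (M.coeff s (A.res f u v) w) = ∑ᶠ i : ℤ, f.coeff i * h.coeff (-1 - i) := by
    have : l (M.coeff s (A.res f u v) w) = (l ∘ₗ (M.coeff s).flip w) (A.res f u v) := rfl
    rw [this, VertexAlgebra.res, map_finsum _ hfin]
    refine finsum_congr fun i => ?_
    rw [map_smul, hcoeff, smul_eq_mul]; rfl
  rw [h1, HahnSeries.coeff_mul]
  rw [finsum_eq_sum_of_support_subset (s := (Finset.antidiagonal f.isPWO_support
    h.isPWO_support (-1)).image Prod.fst), Finset.sum_image]
  · refine Finset.sum_congr rfl fun ij hij => ?_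
    rw [Finset.mem_antidiagonal] at hij
    rw [show -1 - ij.1 = ij.2 by linarith [hij.2.2]]
  · intro a ha b hb hab
    rw [Finset.mem_coe, Finset.mem_antidiagonal] at ha hb
    refine Prod.ext hab ?_
    have := ha.2.2
    have := hb.2.2
    linarith
  · intro i hi
    rw [Finset.mem_coe, Finset.mem_image]
    refine ⟨(i, -1 - i), ?_, rfl⟩
    rw [Finset.mem_antidiagonal]
    refine ⟨fun h0 => hi ?_, fun h0 => hi ?_, by simp⟩
    · simp [h0]
    · simp only at h0 ⊢; rw [h0, mul_zero]

/-- The modes of `Res_x e^{ax} / (e^x - 1)^E Y(u, x) v` in terms of the coefficients of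
`(x₁ - x₂)^K Y_W(u, x₁) Y_W(v, x₂)`. -/
theorem exists_forall_coeff_res_kernel_eq (hT : 0 < T) (u v : V) : ∃ k : ℕ, ∀ K ≥ k, ∀ w : W,
    ∀ (a : ℂ) (E : ℕ) (s : ℤ), M.coeff s (A.res (VertexAlgebra.kernel a E) u v) w =
      ∑ᶠ p : ℤ, (VertexAlgebra.kernel (a + (p : ℂ) / (T : ℂ)) (E + K)).coeff (-1) •
        (mulSub T ^ K) (M.prodCoeff u v w) p (s + T * K - p) := by
  obtain ⟨k, hk⟩ := M.exists_forall_substExp_eq hT u v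
  refine ⟨k, fun K hK w a E s => ?_⟩
  obtain ⟨hF, hF'⟩ := hk K hK w
  obtain ⟨N₁, hN₁⟩ := A.trunc u v
  have hN : ∀ n : ℤ, (N₁.toNat : ℤ) ≤ n → A.Y n u v = 0 := fun n hn => hN₁ n (by omega)
  generalize N₁.toNat = N at hN
  rw [← sub_eq_zero, ← Module.forall_dual_apply_eq_zero_iff ℂ]
  intro l
  have hfin : (fun p : ℤ => (VertexAlgebra.kernel (a + (p : ℂ) / (T : ℂ)) (E + K)).coeff (-1) •
      (mulSub T ^ K) (M.prodCoeff u v w) p (s + T * K - p)).HasFiniteSupport := by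
    refine (hF.hasFiniteSupport (s + T * K)).subset fun p hp h0 => hp ?_
    simp only at h0 ⊢
    rw [h0, smul_zero]
  rw [map_sub, sub_eq_zero, map_finsum _ hfin, M.coeff_res_eq_coeff_mul _ l N s u v w hN]
  have h1 := congrArg (fun f : PowerSeries ℂ => (f : LaurentSeries ℂ)) (hF' N hN l (s + T * K))
  simp only [PowerSeries.coe_mul, PowerSeries.coe_pow, PowerSeries.coe_X, add_sub_cancel_right]
    at h1
  have h0 := PowerSeries.coe_exp_sub_one_ne_zero
  -- Among Laurent series e^x - 1 is invertible, so its K-th power moves into the denominator of the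
  -- kernel.
  have h2 : HahnSeries.single (-(N : ℤ)) (1 : ℂ) *
      ((M.iterSeries l N s u v w : PowerSeries ℂ) : LaurentSeries ℂ) =
      ((substExp T l (s + T * K) ((mulSub T ^ K) (M.prodCoeff u v w)) : PowerSeries ℂ) :
        LaurentSeries ℂ) / ((PowerSeries.exp ℂ - 1 : PowerSeries ℂ) : LaurentSeries ℂ) ^ K := by
    rw [eq_div_iff (pow_ne_zero _ h0)]
    have h3 : HahnSeries.single (-(N : ℤ)) (1 : ℂ) * HahnSeries.single (1 : ℤ) (1 : ℂ) ^ N = 1 := by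
      rw [HahnSeries.single_pow, HahnSeries.single_mul_single]; simp
    linear_combination (-HahnSeries.single (-(N : ℤ)) (1 : ℂ)) * h1 +
      ((substExp T l (s + T * K) ((mulSub T ^ K) (M.prodCoeff u v w)) : PowerSeries ℂ) :
        LaurentSeries ℂ) * h3
  rw [h2]
  set I := Set.Finite.toFinset (hF.hasFiniteSupport (s + T * K)) with hI
  have hsupp : ∀ p, p ∉ I → (mulSub T ^ K) (M.prodCoeff u v w) p (s + T * K - p) = 0 := by
    intro p hp
    by_contra h0
    exact hp ((Set.Finite.mem_toFinset (hF.hasFiniteSupport (s + T * K))).2 h0)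
  have h4 : substExp T l (s + T * K) ((mulSub T ^ K) (M.prodCoeff u v w)) =
      ∑ p ∈ I, l ((mulSub T ^ K) (M.prodCoeff u v w) p (s + T * K - p)) •
        PowerSeries.rescale ((p : ℂ) / (T : ℂ)) (PowerSeries.exp ℂ) := by
    unfold substExp
    refine finsum_eq_sum_of_support_subset _ fun p hp => ?_
    by_contra hc
    refine hp ?_
    simp only
    rw [hsupp p hc, map_zero, zero_smul]
  rw [h4, map_sum, Finset.sum_div, Finset.mul_sum, HahnSeries.coeff_sum,
    finsum_eq_sum_of_support_subset (s := I)]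
  · refine Finset.sum_congr rfl fun p _ => ?_
    rw [← VertexAlgebra.kernel_mul_div, map_smul l, smul_eq_mul, PowerSeries.coe_smul,
      ← HahnSeries.C_mul_eq_smul, mul_div_assoc, mul_left_comm, HahnSeries.C_mul_eq_smul,
      HahnSeries.coeff_smul, smul_eq_mul, mul_comm]
  · intro p hp
    by_contra hc
    refine hp ?_
    simp only
    rw [hsupp p hc, smul_zero, map_zero]

/-- The span of all `v_m w` for a fixed vector `w`. -/
def cyclic (w : W) : Submodule ℂ W :=
  Submodule.span ℂ {x | ∃ (p : ℤ) (v : V), x = M.coeff p v w}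

theorem self_mem_cyclic (w : W) : w ∈ M.cyclic w :=
  Submodule.subset_span ⟨0, A.vac, by simp [M.vac]⟩

/-- By associativity the moments of (x₁ - x₂)^k Y_W(u, x₁) Y_W(v, x₂) w are combinations of modes of
the u_i v applied to w. Interpolation puts its coefficients in the span, and dividing by (x₁ -
x₂)^k, possible as Y_W(v, x₂) w is truncated, does so for u_p v_q w. -/
theorem isSubmodule_cyclic (hT : 0 < T) (w : W) : M.IsSubmodule (M.cyclic w) := by
  intro p u x hx
  induction hx using Submodule.span_induction with
  | zero => simp
  | add x y _ _ hx hy => rw [map_add]; exact Submodule.add_mem _ hx hy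
  | smul c x _ hx => rw [map_smul]; exact Submodule.smul_mem _ _ hx
  | mem x hx =>
    obtain ⟨q, v, rfl⟩ := hx
    obtain ⟨k, hk⟩ := M.exists_assoc u v
    obtain ⟨hF, hs⟩ := hk w
    obtain ⟨N, hN⟩ := M.trunc v w
    refine mem_of_mulSub_pow_apply_mem (X := M.prodCoeff u v w) (M.cyclic w) hT (N := N)
      (fun p q hq => by rw [prodCoeff, hN q hq, map_zero]) k (fun p q => ?_) p q
    have key := mem_of_forall_finsum_pow_smul_mem hT (M.cyclic w)
      (hF.hasFiniteSupport (p + q)) (fun j => ?_) p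
    · simpa using key
    · have h1 := hs j (p + q)
      rw [if_pos (by omega), Int.toNat_natCast] at h1
      have h2 : ∑ᶠ r : ℤ, ((r : ℂ) / (T : ℂ)) ^ j •
          (mulSub T ^ k) (M.prodCoeff u v w) r (p + q - r) = (j.factorial : ℂ) •
          ∑ᶠ r : ℤ, (((r : ℂ) / (T : ℂ)) ^ j / (j.factorial : ℂ)) •
            (mulSub T ^ k) (M.prodCoeff u v w) r (p + q - r) := by
        rw [smul_finsum]
        refine finsum_congr fun r => ?_
        rw [smul_smul]
        congr 1
        have : (j.factorial : ℂ) ≠ 0 := by exact_mod_cast j.factorial_ne_zero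
        field_simp
      rw [h2, ← h1]
      refine Submodule.smul_mem _ _ ?_
      refine finsum_induction (· ∈ M.cyclic w) (Submodule.zero_mem _)
        (fun _ _ => Submodule.add_mem _) fun i => ?_
      exact Submodule.smul_mem _ _ (Submodule.subset_span ⟨_, _, rfl⟩)

end TwistedPhiModule

/-! ### The projection to V^0 and the binomial sums behind •. -/

namespace VertexAlgebra

variable {V : Type*} [AddCommGroup V] [Module ℂ V] {g : V ≃ₗ[ℂ] V} {T : ℕ}

theorem proj₀_mem_eigen (hgT : g ^ T = 1) (u : V) : proj₀ g T u ∈ eigen g T 0 := by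
  rw [eigen, Module.End.mem_eigenspace_iff]
  have h : ∀ j : ℕ, g ((g ^ j) u) = (g ^ (j + 1)) u := fun j => by rw [pow_succ']; rfl
  have h2 : ∑ j ∈ Finset.range T, (g ^ (j + 1)) u = ∑ j ∈ Finset.range T, (g ^ j) u := by
    have h3 := Finset.sum_range_succ (fun j => (g ^ j) u) T
    rw [Finset.sum_range_succ', hgT, pow_zero] at h3
    exact add_right_cancel h3
  simp only [proj₀, LinearEquiv.coe_coe, map_smul, map_sum, h, h2]
  simp

/-- The coefficient with which `(x₁ - x₂)^K Y_W(u, x₁) Y_W(v, x₂)` enters into `o(u • v)`. -/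
def bulletCoeff (N K s : ℕ) : ℂ :=
  ∑ i ∈ Finset.range (N + 1),
    ((-1 : ℂ) ^ i * (Nat.choose (N + i) i : ℂ)) * (Nat.choose (N + K + s) (N + K + i) : ℂ)

/-- From binom(N+i, i) binom(N+s, N+i) = binom(N+s, N) binom(s, i), the sum is a multiple of the
alternating sum of row s of Pascal's triangle, complete because s ≤ N. -/
theorem bulletCoeff_zero_left {N s : ℕ} (hs : s ≤ N) :
    bulletCoeff N 0 s = if s = 0 then 1 else 0 := by
  have h1 : ∀ i ∈ Finset.range (N + 1), ((-1 : ℂ) ^ i * (Nat.choose (N + i) i : ℂ)) *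
      (Nat.choose (N + 0 + s) (N + 0 + i) : ℂ) =
      (Nat.choose (N + s) N : ℂ) * ((-1) ^ i * (Nat.choose s i : ℂ)) := by
    intro i _
    have h2 := Nat.choose_mul (n := N + s) (k := N + i) (s := N) (by omega)
    rw [Nat.add_sub_cancel_left, Nat.add_sub_cancel_left, Nat.choose_symm_add] at h2
    have h3 : (Nat.choose (N + s) (N + i) : ℂ) * (Nat.choose (N + i) i : ℂ) =
      (Nat.choose (N + s) N : ℂ) * (Nat.choose s i : ℂ) := by exact_mod_cast h2
    rw [add_zero]
    linear_combination (-1) ^ i * h3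
  have h4 := Int.alternating_sum_range_choose (n := s)
  have h5 : ∑ m ∈ Finset.range (s + 1), (-1 : ℂ) ^ m * (Nat.choose s m : ℂ) =
      if s = 0 then 1 else 0 := by exact_mod_cast h4
  rw [bulletCoeff, Finset.sum_congr rfl h1, ← Finset.mul_sum,
    ← Finset.sum_subset (Finset.range_mono (Nat.succ_le_succ hs)), h5]
  · split_ifs with h <;> simp [h]
  · intro i _ hi
    rw [Finset.mem_range, not_lt] at hi
    rw [Nat.choose_eq_zero_of_lt (by omega)]; simp

theorem bulletCoeff_succ_zero (N K : ℕ) : bulletCoeff N (K + 1) 0 = bulletCoeff N K 0 := by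
  refine Finset.sum_congr rfl fun i _ => ?_
  congr 2
  rcases Nat.eq_zero_or_pos i with rfl | hi
  · simp
  · rw [Nat.choose_eq_zero_of_lt (by omega), Nat.choose_eq_zero_of_lt (by omega)]

theorem bulletCoeff_succ_succ (N K s : ℕ) :
    bulletCoeff N (K + 1) (s + 1) = bulletCoeff N (K + 1) s + bulletCoeff N K (s + 1) := by
  rw [bulletCoeff, bulletCoeff, bulletCoeff, ← Finset.sum_add_distrib]
  refine Finset.sum_congr rfl fun i _ => ?_
  rw [show N + (K + 1) + (s + 1) = (N + K + (s + 1)) + 1 by ring,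
    show N + (K + 1) + i = (N + K + i) + 1 by ring, Nat.choose_succ_succ,
    show N + (K + 1) + s = N + K + (s + 1) by ring]
  push_cast; ring

/-- Summation by parts; the hypotheses are the Pascal relations linking `bulletCoeff` at K and K +
1. -/
theorem sum_smul_sub_succ {W : Type*} [AddCommGroup W] [Module ℂ W] {c c' : ℕ → ℂ}
    (h0 : c' 0 = c 0) (hs : ∀ s, c' (s + 1) = c' s + c (s + 1)) (Z : ℕ → W) (m : ℕ) :
    ∑ s ∈ Finset.range (m + 1), c' s • (Z s - Z (s + 1)) =
      ∑ s ∈ Finset.range (m + 1), c s • Z s - c' m • Z (m + 1) := by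
  induction m with
  | zero => simp [h0, smul_sub]
  | succ m ih =>
    rw [Finset.sum_range_succ, ih, Finset.sum_range_succ _ (m + 1), hs m, smul_sub, add_smul,
      add_smul]
    abel

/-- Each further factor x₁ - x₂ turns coefficients along the diagonal into differences of
neighbours, and summation by parts returns to the previous K. The boundary term has x₂-index
-T(N+1), where X vanishes. -/
theorem sum_bulletCoeff_smul_mulSub_pow {W : Type*} [AddCommGroup W] [Module ℂ W]
    {X : ℤ → ℤ → W} {N : ℕ} (hX : ∀ p q : ℤ, q ≤ -(T * (N + 1)) → X p q = 0) (K : ℕ) :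
    ∑ s ∈ Finset.range (N + 1), bulletCoeff N K s •
      (mulSub T ^ K) X (T * (K + s)) (-(T * s)) = X 0 0 := by
  induction K with
  | zero =>
    rw [Finset.sum_eq_single 0]
    · rw [bulletCoeff_zero_left (Nat.zero_le _)]; simp
    · intro s hs hs0
      rw [Finset.mem_range] at hs
      rw [bulletCoeff_zero_left (by omega), if_neg hs0, zero_smul]
    · simp
  | succ K ih =>
    have h1 : ∀ s : ℕ, (mulSub T ^ (K + 1)) X (T * ((K + 1 : ℕ) + s)) (-(T * s)) =
        (mulSub T ^ K) X (T * (K + s)) (-(T * s)) -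
          (mulSub T ^ K) X (T * (K + (s + 1 : ℕ))) (-(T * (s + 1 : ℕ))) := by
      intro s
      have e1 : (T : ℤ) * ((K + 1 : ℕ) + s) - T = T * (K + s) := by push_cast; ring
      have e2 : (T : ℤ) * ((K + 1 : ℕ) + s) = T * (K + (s + 1 : ℕ)) := by push_cast; ring
      have e3 : -((T : ℤ) * s) - T = -(T * (s + 1 : ℕ)) := by push_cast; ring
      rw [mulSub_pow_succ_apply, e1, e2, e3]
    simp_rw [h1]
    rw [sum_smul_sub_succ (bulletCoeff_succ_zero N K) (bulletCoeff_succ_succ N K)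
      (fun s : ℕ => (mulSub T ^ K) X (T * (K + s)) (-(T * s))), ih,
      mulSub_pow_apply_eq_zero (Q := fun _ q => q ≤ -((T : ℤ) * (N + 1)))
        (fun _ _ h => ⟨h, by omega⟩) hX K _ _ (by push_cast; exact le_rfl), smul_zero, sub_zero]

end VertexAlgebra

/-! ### Zero modes of u ⋄ v, 𝒟v and u • v on Ω̃_n. -/

namespace TwistedPhiModule

open VertexAlgebra

variable {V : Type*} [AddCommGroup V] [Module ℂ V] {A : VertexAlgebra V} {g : V ≃ₗ[ℂ] V} {T : ℕ}
  {W : Type*} [AddCommGroup W] [Module ℂ W] (M : TwistedPhiModule A g T W)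

theorem coeff_eq_zero_of_mem_eigen (hT : 0 < T) {r : ℕ} {u : V} (hu : u ∈ eigen g T r) {p : ℤ}
    (hp : ¬ (T : ℤ) ∣ p + r) : M.coeff p u = 0 := by
  have hT0 : (T : ℂ) ≠ 0 := by exact_mod_cast hT.ne'
  rw [eigen, Module.End.mem_eigenspace_iff, LinearEquiv.coe_coe] at hu
  have h := M.twist p u
  rw [hu, map_smul, ← sub_eq_zero, ← sub_smul, smul_eq_zero] at h
  refine h.resolve_left fun h0 => hp ?_
  rw [sub_eq_zero, ← Complex.exp_neg, ← Complex.exp_int_mul, Complex.exp_eq_exp_iff_exists_int] at h0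
  obtain ⟨k, hk⟩ := h0
  refine ⟨-k, ?_⟩
  have hpi : (2 * Real.pi * Complex.I : ℂ) ≠ 0 := Complex.two_pi_I_ne_zero
  have h1 : (2 * Real.pi * Complex.I : ℂ) * (((p + r : ℤ) : ℂ) - ((T * -k : ℤ) : ℂ)) = 0 := by
    field_simp at hk
    push_cast
    linear_combination (-(2 * Real.pi * Complex.I : ℂ)) * hk
  have h2 := (mul_eq_zero.1 h1).resolve_left hpi
  exact_mod_cast sub_eq_zero.1 h2

/-- The twist factor at p = 0 is 1, so o(u) sees only the V^0-part of u. This is why • may discard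
the other eigenspaces. -/
theorem coeff_zero_proj₀ (hT : 0 < T) (u : V) : M.coeff 0 (proj₀ g T u) = M.coeff 0 u := by
  have hT0 : (T : ℂ) ≠ 0 := by exact_mod_cast hT.ne'
  have h : ∀ j : ℕ, M.coeff 0 ((g ^ j) u) = M.coeff 0 u := by
    intro j
    induction j with
    | zero => rfl
    | succ j ih =>
      rw [pow_succ', show (g * g ^ j) u = g ((g ^ j) u) from rfl, M.twist, zpow_zero, one_smul, ih]
  rw [proj₀, map_smul, map_sum, Finset.sum_congr rfl fun j _ => h j, Finset.sum_const,
    Finset.card_range, ← Nat.cast_smul_eq_nsmul ℂ, smul_smul, inv_mul_cancel₀ hT0, one_smul]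

theorem coeff_zero_D (hT : 0 < T) (v : V) (w : W) : M.coeff 0 (A.D v) w = 0 := by
  have h := M.coeff_Y_vac hT v 0 1 w
  rw [show (-1 - ((1 : ℕ) : ℤ)) = -2 by norm_num] at h
  rw [D, LinearMap.flip_apply, h]
  simp

theorem exists_forall_mem_Omega (hT : 0 < T) {r n : ℕ} {u : V} (hu : u ∈ eigen g T r) (v : V) :
    ∃ K : ℕ, ∀ w ∈ M.Omega n,
      (∀ p q : ℤ, (mulSub T ^ K) (M.prodCoeff u v w) p q ≠ 0 →
        -(n : ℤ) ≤ p ∧ -(n : ℤ) ≤ q ∧ (T : ℤ) ∣ p + r) ∧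
      ∀ (a : ℂ) (E : ℕ), M.coeff 0 (A.res (kernel a E) u v) w =
        ∑ᶠ p : ℤ, (kernel (a + (p : ℂ) / (T : ℂ)) (E + K)).coeff (-1) •
          (mulSub T ^ K) (M.prodCoeff u v w) p (T * K - p) := by
  obtain ⟨k₁, h₁⟩ := M.exists_mulSub_pow_prodCoeff_eq_flip hT u v
  obtain ⟨k₂, h₂⟩ := M.exists_forall_coeff_res_kernel_eq hT u v
  refine ⟨max k₁ k₂, fun w hw => ⟨fun p q hpq => ⟨?_, ?_, ?_⟩, fun a E => ?_⟩⟩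
  · by_contra hc
    -- Weak commutativity lets u act on w first, so that w ∈ Ω̃_n also bounds the exponent of x₁.
    rw [h₁ _ (le_max_left _ _)] at hpq
    exact hpq (mulSub_pow_apply_eq_zero (Q := fun p _ => p < -(n : ℤ)) (fun _ _ h => ⟨by omega, h⟩)
      (fun p q hp => by rw [prodCoeff, hw u p hp, map_zero]) _ p q (not_le.1 hc))
  · by_contra hc
    exact hpq (mulSub_pow_apply_eq_zero (Q := fun _ q => q < -(n : ℤ)) (fun _ _ h => ⟨h, by omega⟩)
      (fun p q hq => by rw [prodCoeff, hw v q hq, map_zero]) _ p q (not_le.1 hc))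
  · by_contra hc
    refine hpq (mulSub_pow_apply_eq_zero (Q := fun p _ => ¬ (T : ℤ) ∣ p + r)
      (fun p _ h => ⟨fun h' => h ?_, h⟩)
      (fun p q hp => by rw [prodCoeff, M.coeff_eq_zero_of_mem_eigen hT hu hp]; rfl) _ p q hc)
    rw [show p + r = (p - T + r) + T by ring]
    exact dvd_add h' dvd_rfl
  · rw [h₂ (max k₁ k₂) (le_max_right _ _)]
    simp only [zero_add]

theorem coeff_zero_diamond (hT : 0 < T) {r n : ℕ} (hr : r < T) {u : V} (hu : u ∈ eigen g T r)
    (v : V) {w : W} (hw : w ∈ M.Omega n) : M.coeff 0 (A.diamond T n r u v) w = 0 := by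
  have hT0 : (T : ℂ) ≠ 0 := by exact_mod_cast hT.ne'
  obtain ⟨K, hK⟩ := M.exists_forall_mem_Omega hT (n := n) hu v
  obtain ⟨hF, hres⟩ := hK w hw
  rw [diamond, hres]
  refine finsum_eq_zero_of_forall_eq_zero fun p => ?_
  by_cases h0 : (mulSub T ^ K) (M.prodCoeff u v w) p (T * K - p) = 0
  · rw [h0, smul_zero]
  obtain ⟨hp, hq, j, hj⟩ := hF _ _ h0
  have hn : (T : ℤ) * (n / T : ℕ) + (n % T : ℕ) = n := by exact_mod_cast Nat.div_add_mod n T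
  have hb : n % T < T := Nat.mod_lt _ hT
  generalize n / T = N at *
  generalize n % T = nb at *
  -- With p + r = T j the residue is binom(b, M) for b = j + N - 1 + δ(r) and M = 2N + δ(r) + δ(T -
  -- r) + K. The bound p ≥ -n gives b ≥ 0, and T K - p ≥ -n gives b < M; the two δ's record whether
  -- the fractional part of n allows one more value of j at either end.
  have key : 0 ≤ j + N - 1 + δ nb r ∧
      j + N - 1 + δ nb r < 2 * N + δ nb r + δ nb (T - r) + K := by
    have hTz : (0 : ℤ) < T := by exact_mod_cast hT
    unfold δ
    constructor
    · split_ifs with h1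
      · have : (T : ℤ) * 0 < T * (j + N + 1) := by linarith
        have := lt_of_mul_lt_mul_left this hTz.le
        push_cast; omega
      · have : (T : ℤ) * 0 < T * (j + N) := by
          have : (nb : ℤ) < r := by omega
          linarith
        have := lt_of_mul_lt_mul_left this hTz.le
        push_cast; omega
    · by_cases h2 : T - r ≤ nb
      · have : (T : ℤ) * j < T * (K + N + 2) := by linarith
        have := lt_of_mul_lt_mul_left this hTz.le
        rw [if_pos h2]
        push_cast; omega
      · have : (T : ℤ) * j < T * (K + N + 1) := by
          have : (nb : ℤ) + r < T := by omega
          linarith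
        have := lt_of_mul_lt_mul_left this hTz.le
        rw [if_neg h2]
        push_cast; omega
  obtain ⟨b, hb'⟩ := Int.eq_ofNat_of_zero_le key.1
  have ha : (δ nb r : ℂ) + (N : ℂ) + (r : ℂ) / (T : ℂ) + (p : ℂ) / (T : ℂ) = (b : ℂ) + 1 := by
    have e1 : (p : ℂ) + r = T * j := by exact_mod_cast hj
    have e2 : (j : ℂ) + N - 1 + δ nb r = b := by exact_mod_cast hb'
    field_simp
    linear_combination e1 + T * e2
  rw [ha, show 2 * N + δ nb r + δ nb (T - r) + 1 + K = 2 * N + δ nb r + δ nb (T - r) + K + 1 by ring,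
    coeff_kernel_natCast_add_one, Nat.choose_eq_zero_of_lt (by omega), Nat.cast_zero, zero_smul]

theorem coeff_zero_bullet (hT : 0 < T) (hgT : g ^ T = 1) {n : ℕ} (u v : V) {w : W}
    (hw : w ∈ M.Omega n) : M.coeff 0 (A.bullet g T n u v) w = M.coeff 0 u (M.coeff 0 v w) := by
  have hT0 : (T : ℂ) ≠ 0 := by exact_mod_cast hT.ne'
  have hTz : (0 : ℤ) < T := by exact_mod_cast hT
  have hu := proj₀_mem_eigen hgT u
  rw [← M.coeff_zero_proj₀ hT u, bullet]
  generalize proj₀ g T u = u at *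
  obtain ⟨K, hK⟩ := M.exists_forall_mem_Omega hT (n := n) hu v
  obtain ⟨hF, hres⟩ := hK w hw
  have hn : (T : ℤ) * (n / T : ℕ) + (n % T : ℕ) = n := by exact_mod_cast Nat.div_add_mod n T
  have hb : n % T < T := Nat.mod_lt _ hT
  generalize n / T = N at *
  generalize n % T = nb at *
  -- On V^0 the exponent is p = T j, and the residue is binom(N + j, N + K + i). It vanishes for j <
  -- K, while the bound on the x₂-exponent gives j ≤ K + N; hence j = K + s with 0 ≤ s ≤ N.
  have hterm : ∀ i : ℕ, M.coeff 0 (A.res (kernel ((N : ℂ) + 1) (N + 1 + i)) u v) w =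
      ∑ s ∈ Finset.range (N + 1), (Nat.choose (N + K + s) (N + K + i) : ℂ) •
        (mulSub T ^ K) (M.prodCoeff u v w) (T * (K + s)) (-(T * s)) := by
    intro i
    rw [hres, finsum_eq_sum_of_support_subset
      (s := (Finset.range (N + 1)).image fun s : ℕ => (T : ℤ) * (K + s)), Finset.sum_image]
    · refine Finset.sum_congr rfl fun s _ => ?_
      have ha : (N : ℂ) + 1 + ((T * (K + s) : ℤ) : ℂ) / (T : ℂ) = ((N + K + s : ℕ) : ℂ) + 1 := by
        push_cast
        field_simp
        ring
      rw [ha, show N + 1 + i + K = N + K + i + 1 by ring, coeff_kernel_natCast_add_one,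
        show (T : ℤ) * K - T * (K + s) = -(T * s) by ring]
    · intro a _ b _ hab
      have := mul_left_cancel₀ hTz.ne' hab
      omega
    · intro p hp
      rw [Function.mem_support, smul_ne_zero_iff] at hp
      obtain ⟨h1, h2⟩ := hp
      obtain ⟨hp, hq, j, hj⟩ := hF _ _ h2
      rw [Nat.cast_zero, add_zero] at hj
      subst hj
      have hj1 : -(N : ℤ) ≤ j := by
        have : (T : ℤ) * 0 < T * (j + N + 1) := by linarith
        have := lt_of_mul_lt_mul_left this hTz.le
        omega
      have hj2 : j ≤ K + N := by
        have : (T : ℤ) * j < T * (K + N + 1) := by linarith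
        have := lt_of_mul_lt_mul_left this hTz.le
        omega
      obtain ⟨b, hb'⟩ := Int.eq_ofNat_of_zero_le (show 0 ≤ j + N by omega)
      have ha : (N : ℂ) + 1 + ((T * j : ℤ) : ℂ) / (T : ℂ) = (b : ℂ) + 1 := by
        have e2 : (j : ℂ) + N = b := by exact_mod_cast hb'
        push_cast
        field_simp
        linear_combination e2
      rw [ha, show N + 1 + i + K = N + K + i + 1 by ring, coeff_kernel_natCast_add_one] at h1
      have h3 : N + K + i ≤ b := by
        by_contra hc
        exact h1 (by rw [Nat.choose_eq_zero_of_lt (by omega), Nat.cast_zero])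
      rw [Finset.mem_coe, Finset.mem_image]
      refine ⟨(j - K).toNat, Finset.mem_range.2 (by omega), ?_⟩
      congr 1
      omega
  have hX : ∀ p q : ℤ, q ≤ -(T * (N + 1)) → M.prodCoeff u v w p q = 0 := by
    intro p q hq
    rw [prodCoeff, hw v q (by linarith), map_zero]
  have h5 := sum_bulletCoeff_smul_mulSub_pow hX K
  rw [prodCoeff] at h5
  rw [← h5, map_sum, LinearMap.sum_apply]
  simp_rw [map_smul, LinearMap.smul_apply, hterm, bulletCoeff, Finset.sum_smul, Finset.smul_sum,
    smul_smul]
  exact Finset.sum_comm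

end TwistedPhiModule

/-! ### Homogeneous components and simplicity. -/

namespace GradedTwistedPhiModule

open VertexAlgebra

variable {V : Type*} [AddCommGroup V] [Module ℂ V] {A : VertexAlgebra V} {g : V ≃ₗ[ℂ] V} {T : ℕ}
  {W : Type*} [AddCommGroup W] [Module ℂ W] (M : GradedTwistedPhiModule A g T W)

theorem degLE_le_Omega (n : ℕ) : M.degLE n ≤ M.Omega n :=
  iSup₂_le fun i hi _ hw v p hp => M.coeff_eq_zero p v i (by omega) _ hw

theorem deg_le_degLE {i n : ℕ} (hi : i ≤ n) : M.deg i ≤ M.degLE n :=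
  le_iSup₂_of_le i hi le_rfl

open Classical in
/-- The projection of `W` onto its homogeneous component of degree `j / T`. -/
noncomputable def component (j : ℕ) : W →ₗ[ℂ] W :=
  letI := M.isInternal.chooseDecomposition
  (M.deg j).subtype ∘ₗ DirectSum.component ℂ ℕ (fun i => M.deg i) j ∘ₗ
    (DirectSum.decomposeLinearEquiv M.deg).toLinearMap

theorem component_mem (j : ℕ) (w : W) : M.component j w ∈ M.deg j :=
  Submodule.coe_mem _

theorem component_of_mem {i : ℕ} {w : W} (hw : w ∈ M.deg i) (j : ℕ) :
    M.component j w = if i = j then w else 0 := by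
  classical
  let := M.isInternal.chooseDecomposition
  have h : M.component j w = (DirectSum.decompose M.deg w j : W) := rfl
  rw [h]
  split_ifs with hij
  · subst hij
    exact DirectSum.decompose_of_mem_same _ hw
  · exact DirectSum.decompose_of_mem_ne _ hw hij

theorem mem_of_forall_component_mem {S : Submodule ℂ W} {w : W}
    (h : ∀ j, M.component j w ∈ S) : w ∈ S := by
  classical
  let := M.isInternal.chooseDecomposition
  rw [← DirectSum.sum_support_decompose M.deg w]
  exact S.sum_mem fun j _ => h j

theorem component_coeff {p : ℤ} {i j : ℕ} (hij : (j : ℤ) = i + p) (v : V) (w : W) :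
    M.component j (M.coeff p v w) = M.coeff p v (M.component i w) := by
  have hw : w ∈ ⨆ i, M.deg i := by
    rw [M.isInternal.submodule_iSup_eq_top]; exact Submodule.mem_top
  induction hw using Submodule.iSup_induction' with
  | zero => simp
  | add x y _ _ hx hy => rw [map_add, map_add, map_add, map_add, hx, hy]
  | mem k x hx =>
    rw [M.component_of_mem hx]
    by_cases hk : (k : ℤ) + p < 0
    · rw [M.coeff_eq_zero p v k hk x hx, map_zero, if_neg (by omega), map_zero]
    · obtain ⟨j', hj'⟩ := Int.eq_ofNat_of_zero_le (not_lt.1 hk)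
      rw [M.component_of_mem (M.coeff_mem p v k j' hj'.symm x hx)]
      by_cases hki : k = i
      · rw [if_pos hki, if_pos (by omega)]
      · rw [if_neg hki, if_neg (by omega), map_zero]

theorem component_mem_Omega {n : ℕ} {w : W} (hw : w ∈ M.Omega n) (i : ℕ) :
    M.component i w ∈ M.Omega n := by
  intro v p hp
  by_cases hi : (i : ℤ) + p < 0
  · exact M.coeff_eq_zero p v i hi _ (M.component_mem i w)
  · obtain ⟨j, hj⟩ := Int.eq_ofNat_of_zero_le (not_lt.1 hi)
    rw [← M.component_coeff hj.symm, hw v p hp, map_zero]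

theorem isGradedSubmodule_cyclic (hT : 0 < T) {i : ℕ} {w : W} (hw : w ∈ M.deg i) :
    M.IsGradedSubmodule (M.cyclic w) := by
  refine ⟨M.isSubmodule_cyclic hT w, le_antisymm ?_ (iSup_le fun _ => inf_le_left)⟩
  refine Submodule.span_le.2 ?_
  rintro _ ⟨p, v, rfl⟩
  by_cases hi : (i : ℤ) + p < 0
  · rw [M.coeff_eq_zero p v i hi w hw]
    exact Submodule.zero_mem _
  · obtain ⟨j, hj⟩ := Int.eq_ofNat_of_zero_le (not_lt.1 hi)
    exact Submodule.mem_iSup_of_mem j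
      ⟨Submodule.subset_span ⟨p, v, rfl⟩, M.coeff_mem p v i j hj.symm w hw⟩

/-- Only modes of shift j - i contribute in degree j, and a sum of such modes is again one mode by
linearity in v. -/
theorem component_mem_range_of_mem_cyclic {i : ℕ} {w x : W} (hw : w ∈ M.deg i)
    (hx : x ∈ M.cyclic w) (j : ℕ) :
    M.component j x ∈ LinearMap.range ((M.coeff (j - i)).flip w) := by
  induction hx using Submodule.span_induction with
  | zero => rw [map_zero]; exact Submodule.zero_mem _
  | add x y _ _ hx hy => rw [map_add]; exact Submodule.add_mem _ hx hy
  | smul c x _ hx => rw [map_smul]; exact Submodule.smul_mem _ _ hx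
  | mem x hx =>
    obtain ⟨p, v, rfl⟩ := hx
    by_cases hi : (i : ℤ) + p < 0
    · rw [M.coeff_eq_zero p v i hi w hw, map_zero]
      exact Submodule.zero_mem _
    · obtain ⟨j', hj'⟩ := Int.eq_ofNat_of_zero_le (not_lt.1 hi)
      rw [M.component_of_mem (M.coeff_mem p v i j' hj'.symm w hw)]
      split_ifs with h
      · exact ⟨v, by rw [LinearMap.flip_apply, show (j : ℤ) - i = p by omega]⟩
      · exact Submodule.zero_mem _

/-- In a simple module, the modes of the right degree map a nonzero homogeneous vector to any given
homogeneous vector. -/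
theorem IsSimple.exists_coeff_eq {M : GradedTwistedPhiModule A g T W} (hM : M.IsSimple)
    (hT : 0 < T) {i j : ℕ} {w x : W} (hw : w ∈ M.deg i) (hw0 : w ≠ 0) (hx : x ∈ M.deg j) :
    ∃ v : V, M.coeff (j - i) v w = x := by
  have htop : M.cyclic w = ⊤ :=
    (hM.eq_bot_or_eq_top _ (M.isGradedSubmodule_cyclic hT hw)).resolve_left fun h =>
      hw0 ((Submodule.mem_bot ℂ).1 (h ▸ M.self_mem_cyclic w))
  have h := M.component_mem_range_of_mem_cyclic hw (x := x) (htop ▸ Submodule.mem_top) j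
  rw [M.component_of_mem hx, if_pos rfl] at h
  exact h

/-- A nonzero component in degree i > n would again lie in Ω̃_n, yet some mode of shift -i < -n
would carry it to a nonzero vector of M(0). -/
theorem IsSimple.Omega_eq_degLE {M : GradedTwistedPhiModule A g T W} (hM : M.IsSimple)
    (hT : 0 < T) (h0 : M.deg 0 ≠ ⊥) (n : ℕ) : M.Omega n = M.degLE n := by
  refine le_antisymm (fun w hw => M.mem_of_forall_component_mem fun i => ?_) (M.degLE_le_Omega n)
  by_cases hi : i ≤ n
  · exact M.deg_le_degLE hi (M.component_mem i w)
  by_cases hw0 : M.component i w = 0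
  · rw [hw0]; exact Submodule.zero_mem _
  obtain ⟨x, hx, hx0⟩ := Submodule.exists_mem_ne_zero_of_ne_bot h0
  obtain ⟨v, hv⟩ := hM.exists_coeff_eq hT (M.component_mem i w) hw0 hx
  exact absurd (hv.symm.trans (M.component_mem_Omega hw i v _ (by push_cast; omega))) hx0

theorem o_mem (v : V) {m : ℕ} {w : W} (hw : w ∈ M.deg m) : M.o v w ∈ M.deg m :=
  M.coeff_mem 0 v m m (by simp) w hw

/-- The operators `o(v)`, restricted to a homogeneous component. -/
def oRestrict (m : ℕ) : V →ₗ[ℂ] Module.End ℂ (M.deg m) where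
  toFun v := (M.o v).restrict fun _ hw => M.o_mem v hw
  map_add' u v := by ext w; simp [TwistedPhiModule.o]
  map_smul' c v := by ext w; simp [TwistedPhiModule.o]

theorem coe_oRestrict_apply (m : ℕ) (v : V) (w : M.deg m) :
    (M.oRestrict m v w : W) = M.coeff 0 v w := rfl

theorem O_le_ker_oRestrict (hT : 0 < T) {m n : ℕ} (hmn : m ≤ n) :
    A.O g T n ≤ LinearMap.ker (M.oRestrict m) := by
  have hΩ : ∀ w : M.deg m, (w : W) ∈ M.Omega n := fun w =>
    M.degLE_le_Omega n (M.deg_le_degLE hmn w.2)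
  refine sup_le (Submodule.span_le.2 ?_) ?_
  · rintro _ ⟨r, hr, u, hu, v, rfl⟩
    refine LinearMap.mem_ker.2 (LinearMap.ext fun w => Subtype.ext ?_)
    rw [coe_oRestrict_apply, M.coeff_zero_diamond hT hr hu v (hΩ w)]; rfl
  · rintro _ ⟨v, rfl⟩
    refine LinearMap.mem_ker.2 (LinearMap.ext fun w => Subtype.ext ?_)
    rw [coe_oRestrict_apply, M.coeff_zero_D hT]; rfl

end GradedTwistedPhiModule

/-- The natural numbers `n`, `m`, `i` stand for the elements `n/T`, `m/T`, `i/T` of `(1/T)ℕ`. -/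
theorem proposition4p5 {V : Type*} [AddCommGroup V] [Module ℂ V] (A : VertexAlgebra V)
    (g : V ≃ₗ[ℂ] V) (hg : A.IsAutomorphism g) (T : ℕ) (hT : 0 < T) (hgT : orderOf g = T)
    {W : Type*} [AddCommGroup W] [Module ℂ W] (M : GradedTwistedPhiModule A g T W) (n : ℕ) :
    M.degLE n ≤ M.Omega n ∧
    (M.IsSimple → M.deg 0 ≠ ⊥ → M.Omega n = M.degLE n) ∧
    (M.IsSimple → ∀ m : ℕ, m ≤ n → M.deg m ≠ ⊥ →
      ∃ ρ : A.Zhu g T n →ₗ[ℂ] Module.End ℂ (M.deg m),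
        (∀ (v : V) (w : M.deg m), (ρ (Submodule.Quotient.mk v) w : W) = M.o v w) ∧
        A.IsIrreducibleZhuModule g T n ρ) := by
  refine ⟨M.degLE_le_Omega n, fun hM h0 => hM.Omega_eq_degLE hT h0 n, fun hM m hmn hm => ?_⟩
  have hgT' : g ^ T = 1 := hgT ▸ pow_orderOf_eq_one g
  refine ⟨(A.O g T n).liftQ (M.oRestrict m) (M.O_le_ker_oRestrict hT hmn), fun v w => rfl,
    { map_one := ?_, map_mul := ?_, nontrivial := ?_, eq_bot_or_eq_top := ?_ }⟩
  · ext w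
    rw [Submodule.liftQ_apply, M.coe_oRestrict_apply, M.vac, if_pos rfl]; rfl
  · intro u v
    ext w
    simp only [Submodule.liftQ_apply, Module.End.mul_apply, M.coe_oRestrict_apply]
    exact M.coeff_zero_bullet hT hgT' u v (M.degLE_le_Omega n (M.deg_le_degLE hmn w.2))
  · exact Submodule.nontrivial_iff_ne_bot.2 hm
  · intro N hN
    refine or_iff_not_imp_left.2 fun hN0 => ?_
    -- One nonzero w in N suffices: any x in M(m) is o(v) w for some v, the shift being m - m = 0.
    obtain ⟨w, hw, hw0⟩ := Submodule.exists_mem_ne_zero_of_ne_bot hN0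
    refine eq_top_iff.2 fun x _ => ?_
    obtain ⟨v, hv⟩ := hM.exists_coeff_eq hT w.2 (fun h => hw0 (Subtype.ext h)) x.2
    rw [sub_self] at hv
    have : x = (A.O g T n).liftQ (M.oRestrict m) (M.O_le_ker_oRestrict hT hmn)
        (Submodule.Quotient.mk v) w := Subtype.ext hv.symm
    rw [this]
    exact hN _ _ hw
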